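/- Let $(N,\phi,\xi,\eta,g)$ be a $(2n+1)$-dimensional almost contact metric manifold, that is, a smooth manifold with a $(1,1)$-tensor field $\phi$, a vector field $\xi$, a $1$-form $\eta$ and a Riemannian metric $g$, all smooth, such that $\phi^2=-I+\eta\otimes\xi$, $\eta(\xi)=1$ and $g(\phi X,\phi Y)=g(X,Y)-\eta(X)\eta(Y)$. Let $\overline\nabla$ be the Levi-Civita connection of $g$. $N$ is *Kenmotsu* if $(\overline\nabla_X\phi)Y=g(\phi X,Y)\xi-\eta(Y)\phi X$ for all vector fields $X,Y$. $N$ is *cosymplectic* if $\eta$ and the $2$-form $\Phi(X,Y)=g(X,\phi Y)$ are closed and $\phi^2[X,Y]+[\phi X,\phi Y]-\phi[\phi X,Y]-\phi[X,\phi Y]+2d\eta(X,Y)\xi=0$ for all vector fields $X,Y$, where $2d\eta(X,Y)=X\eta(Y)-Y\eta(X)-\eta([X,Y])$. Let $(B,g_B)$ and $(\overline F,g_{\overline F})$ be Riemannian manifolds of dimensions $2m_1$ and $2m_2$, let $f$ be a positive smooth function on $B$, and let $M=B\times_f\overline F$ be the warped product, i.e. $B\times\overline F$ with the metric $g_B+f^2g_{\overline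 F}$. Suppose that $M$ is an (isometrically immersed) submanifold of $N$ which is proper pointwise semi-slant with $\mathcal D_1=TB$, $\mathcal D_2=T\overline F$ and semi-slant function $\theta$: $\phi(TB)\subset TB$, and at each $p\in M$ the angle between $\phi X$ and the space $(T\overline F)_p$ has the same value $\theta(p)\in(0,\frac{\pi}{2})$ for all nonzero $X\in(T\overline F)_p$. Suppose that $\xi$ is normal to $M$ and that $\xi\in\Gamma(\mu)$, where $\mu$ is the orthogonal complement of $F\mathcal D_2$ in the normal bundle $TM^\perp$ and $FX$ denotes the normal part of $\phi X$. Assume that $n=m_1+2m_2$. Let $h$ be the second fundamental form of $M$ in $N$, let $\|h\|^2=\sum_{i,j}g(h(e_i,e_j),h(e_i,e_j))$ for an orthonormal basis $(e_i)$ of the tangent space of $M$, and let $\nabla(\ln f)$ be the gradient of $\ln f$. 1. If $N$ is Kenmotsu, then at every point of $M$ $$\|h\|^2\ \ge\ 4m_2(\csc^2\theta+\cot^2\theta)\,\|\nabla(\ln f)\|^2+2m_1,$$ with equality holding if and only if $g(h(Z,W),V)=0$ for all $Z,W\in T\overline F$ and $V\in TM^\perp$ at that point. 2. If $N$ is cosymplectic,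 then at every point of $M$ $$\|h\|^2\ \ge\ 4m_2(\csc^2\theta+\cot^2\theta)\,\|\nabla(\ln f)\|^2,$$ with equality holding if and only if $g(h(Z,W),V)=0$ for all $Z,W\in T\overline F$ and $V\in TM^\perp$ at that point. -/

import Mathlib

open Bundle Manifold
open scoped ContDiff

namespace SemiSlant

noncomputable section

section Ambient

variable {E : Type*} [NormedAddCommGroup E] [NormedSpace ℝ E] [FiniteDimensional ℝ E]
  {H : Type*} [TopologicalSpace H] {I : ModelWithCorners ℝ E H}
  {N : Type*} [TopologicalSpace N] [ChartedSpace H N] [IsManifold I ∞ N]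
  [RiemannianBundle (fun x : N => TangentSpace I x)]
  [IsContMDiffRiemannianBundle I ∞ E (fun x : N => TangentSpace I x)]

/-- `nabla` is the Levi-Civita connection of the Riemannian manifold `N`: it is torsion free and
compatible with the metric. Mathlib writes `nabla Y x u` for `(∇_u Y)(x)`. -/
structure IsLeviCivita
    (nabla : CovariantDerivative I E (fun x : N => TangentSpace I x)) : Prop where
  torsion_eq_zero : nabla.torsion = 0
  metric : ∀ (x : N) (u : TangentSpace I x) (Y Z : ∀ y : N, TangentSpace I y),
    MDifferentiableAt I I.tangent (fun y => (TotalSpace.mk' E y (Y y) : TangentBundle I N)) x →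
    MDifferentiableAt I I.tangent (fun y => (TotalSpace.mk' E y (Z y) : TangentBundle I N)) x →
    mvfderiv I (fun y => (inner ℝ (Y y) (Z y) : ℝ)) x u
      = inner ℝ (nabla Y x u) (Z x) + inner ℝ (Y x) (nabla Z x u)

/-- The vector field `X` is `C^∞` at the point `x`. -/
def SmoothFieldAt (X : ∀ x : N, TangentSpace I x) (x : N) : Prop :=
  ContMDiffAt I I.tangent ∞ (fun y => (TotalSpace.mk' E y (X y) : TangentBundle I N)) x

variable (I N) in
/-- An almost contact metric structure `(φ, ξ, η, g)` on `N`, where `g` is the given Riemannian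
metric of `N`. -/
structure AlmostContactMetric where
  /-- the tensor field `φ` of type `(1,1)` -/
  phi : ∀ x : N, TangentSpace I x →L[ℝ] TangentSpace I x
  /-- the vector field `ξ` -/
  xi : ∀ x : N, TangentSpace I x
  /-- the `1`-form `η` -/
  eta : ∀ x : N, TangentSpace I x →L[ℝ] ℝ
  phi_smooth : ContMDiff I (I.prod 𝓘(ℝ, E →L[ℝ] E)) ∞ (fun x =>
    (TotalSpace.mk' (E →L[ℝ] E) x (phi x) :
      TotalSpace (E →L[ℝ] E) (fun x : N => TangentSpace I x →L[ℝ] TangentSpace I x)))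
  xi_smooth : ∀ x, SmoothFieldAt xi x
  eta_smooth : ContMDiff I (I.prod 𝓘(ℝ, E →L[ℝ] ℝ)) ∞ (fun x =>
    (TotalSpace.mk' (E →L[ℝ] ℝ) x (eta x) :
      TotalSpace (E →L[ℝ] ℝ) (fun x : N => TangentSpace I x →L[ℝ] ℝ)))
  phi_phi : ∀ x (u : TangentSpace I x), phi x (phi x u) = -u + eta x u • xi x
  eta_xi : ∀ x, eta x (xi x) = 1
  compatible : ∀ x (u v : TangentSpace I x),
    inner ℝ (phi x u) (phi x v) = inner ℝ u v - eta x u * eta x v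

namespace AlmostContactMetric

variable (A : AlmostContactMetric I N)

/-- The vector field `φ X`. -/
def phiField (X : ∀ x : N, TangentSpace I x) (x : N) : TangentSpace I x := A.phi x (X x)

/-- The fundamental `2`-form `Φ(X, Y) = g(X, φ Y)`, evaluated on vector fields. -/
def fundForm (X Y : ∀ x : N, TangentSpace I x) (x : N) : ℝ := inner ℝ (X x) (A.phi x (Y x))

/-- `dη(X, Y)`, normalised so that `2 dη(X, Y) = X η(Y) - Y η(X) - η([X, Y])`. -/
def dEta (X Y : ∀ x : N, TangentSpace I x) (x : N) : ℝ :=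
  (1 / 2) * (mvfderiv I (fun y => A.eta y (Y y)) x (X x)
    - mvfderiv I (fun y => A.eta y (X y)) x (Y x)
    - A.eta x (VectorField.mlieBracket I X Y x))

/-- `dΦ(X, Y, Z)`, normalised so that `3 dΦ(X, Y, Z)` is the alternating sum below. -/
def dFundForm (X Y Z : ∀ x : N, TangentSpace I x) (x : N) : ℝ :=
  (1 / 3) * (mvfderiv I (A.fundForm Y Z) x (X x)
    - mvfderiv I (A.fundForm X Z) x (Y x)
    + mvfderiv I (A.fundForm X Y) x (Z x)
    - A.fundForm (VectorField.mlieBracket I X Y) Z x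
    + A.fundForm (VectorField.mlieBracket I X Z) Y x
    - A.fundForm (VectorField.mlieBracket I Y Z) X x)

/-- The Nijenhuis tensor
`N(X, Y) = φ²[X, Y] + [φX, φY] - φ[φX, Y] - φ[X, φY]` of `φ`. -/
def nijenhuis (X Y : ∀ x : N, TangentSpace I x) (x : N) : TangentSpace I x :=
  A.phi x (A.phi x (VectorField.mlieBracket I X Y x))
    + VectorField.mlieBracket I (A.phiField X) (A.phiField Y) x
    - A.phi x (VectorField.mlieBracket I (A.phiField X) Y x)
    - A.phi x (VectorField.mlieBracket I X (A.phiField Y) x)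

/-- `N` is cosymplectic: `η` and `Φ` are closed and the almost contact structure is normal,
i.e. `N(X, Y) + 2 dη(X, Y) ξ = 0`. -/
structure IsCosymplectic : Prop where
  eta_closed : ∀ x (X Y : ∀ x : N, TangentSpace I x),
    SmoothFieldAt X x → SmoothFieldAt Y x → A.dEta X Y x = 0
  fundForm_closed : ∀ x (X Y Z : ∀ x : N, TangentSpace I x),
    SmoothFieldAt X x → SmoothFieldAt Y x → SmoothFieldAt Z x → A.dFundForm X Y Z x = 0
  normal : ∀ x (X Y : ∀ x : N, TangentSpace I x),
    SmoothFieldAt X x → SmoothFieldAt Y x →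
      A.nijenhuis X Y x + (2 * A.dEta X Y x) • A.xi x = 0

/-- `N` is Kenmotsu: `(∇_X φ) Y = g(φ X, Y) ξ - η(Y) φ X`, where
`(∇_X φ) Y = ∇_X (φ Y) - φ (∇_X Y)` and `nabla` is the Levi-Civita connection. -/
def IsKenmotsu (nabla : CovariantDerivative I E (fun x : N => TangentSpace I x)) : Prop :=
  ∀ x (u : TangentSpace I x) (Y : ∀ x : N, TangentSpace I x), SmoothFieldAt Y x →
    nabla (A.phiField Y) x u - A.phi x (nabla Y x u)
      = (inner ℝ (A.phi x u) (Y x) : ℝ) • A.xi x - A.eta x (Y x) • A.phi x u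

end AlmostContactMetric

end Ambient

section Submanifold

variable {E : Type*} [NormedAddCommGroup E] [NormedSpace ℝ E] [FiniteDimensional ℝ E]
  {H : Type*} [TopologicalSpace H] {I : ModelWithCorners ℝ E H}
  {N : Type*} [TopologicalSpace N] [ChartedSpace H N] [IsManifold I ∞ N]
  {E' : Type*} [NormedAddCommGroup E'] [NormedSpace ℝ E']
  {H' : Type*} [TopologicalSpace H'] (J : ModelWithCorners ℝ E' H')
  {M : Type*} [TopologicalSpace M] [ChartedSpace H' M]

/-- The covariant derivative `∇_u V` at `p`, along a map `ι : M → N`, of a vector field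
`V` along `ι` (so that `V x ∈ T_{ι x} N`). In the frame `(e_i)` of `TN` around `ι p` that is
constant in the preferred trivialization at `ι p`, with `V = ∑ V^i e_i`, it is
`∑ (u V^i) e_i + ∑ V^i ∇_{dι u} e_i`: the first term below is the first sum, and
`FiberBundle.extend E (V p)` is the field `∑ V^i(p) e_i`.
See `covDerivAlong_comp` for the comparison with `∇`. -/
def covDerivAlong (nabla : CovariantDerivative I E (fun x : N => TangentSpace I x))
    (ι : M → N) (V : ∀ x : M, TangentSpace I (ι x)) (p : M) (u : TangentSpace J p) :
    TangentSpace I (ι p) :=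
  (trivializationAt E (fun x : N => TangentSpace I x) (ι p)).symm (ι p)
      (mvfderiv J (fun x => (trivializationAt E (fun x : N => TangentSpace I x) (ι p)
        (TotalSpace.mk' E (ι x) (V x))).2) p u)
    + nabla (FiberBundle.extend E (V p)) (ι p) (mfderiv J I ι p u)

set_option maxHeartbeats 1000000 in
/-- If `V = Y ∘ ι` is the restriction of a vector field `Y` of `N`, then `∇_u V = ∇_{dι u} Y`. -/
theorem covDerivAlong_comp (nabla : CovariantDerivative I E (fun x : N => TangentSpace I x))
    {ι : M → N} {p : M} (hι : MDifferentiableAt J I ι p) {Y : ∀ y : N, TangentSpace I y}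
    (hY : MDifferentiableAt I I.tangent
      (fun y => (TotalSpace.mk' E y (Y y) : TangentBundle I N)) (ι p))
    (u : TangentSpace J p) :
    covDerivAlong J nabla ι (fun x => Y (ι x)) p u = nabla Y (ι p) (mfderiv J I ι p u) := by
  set q := ι p with hq
  set t := trivializationAt E (fun x : N => TangentSpace I x) q with ht
  set w := mfderiv J I ι p u with hw
  have hqt : q ∈ t.baseSet := FiberBundle.mem_baseSet_trivializationAt' q
  have hev : ∀ᶠ y in nhds q, y ∈ t.baseSet := t.open_baseSet.mem_nhds hqt
  let c : (∀ y : N, TangentSpace I y) → N → E := fun σ y => (t (TotalSpace.mk' E y (σ y))).2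
  have hc : ∀ {σ : ∀ y : N, TangentSpace I y}, MDifferentiableAt I I.tangent
      (fun y => (TotalSpace.mk' E y (σ y) : TangentBundle I N)) q →
      MDifferentiableAt I 𝓘(ℝ, E) (c σ) q := fun {σ} hσ =>
    ((mdifferentiableAt_totalSpace I _).1 hσ).2
  have hcongr : ∀ {a b : N → E}, a =ᶠ[nhds q] b → mvfderiv I a q = mvfderiv I b q := by
    intro a b hab
    ext v
    simp only [mvfderiv, hab.mfderiv_eq]
    rfl
  let Φ : (∀ y : N, TangentSpace I y) → TangentSpace I q := fun σ =>
    nabla σ q w - t.symmL ℝ q (mvfderiv I (c σ) q w)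
  have hΦ : TensorialAt I E Φ q := by
    refine ⟨fun {g σ} hg hσ => ?_, fun {σ σ'} hσ hσ' => ?_⟩
    · have h1 : c (g • σ) =ᶠ[nhds q] fun y => g y • c σ y := by
        filter_upwards [hev] with y hy
        exact (t.linear ℝ hy).map_smul (g y) (σ y)
      have h2 : mvfderiv I (c (g • σ)) q = mvfderiv I (fun y => g y • c σ y) q :=
        hcongr h1
      have h3 := nabla.isCovariantDerivativeOn.leibniz hσ hg
      have h4 : t.symmL ℝ q (c σ q) = σ q := by
        rw [t.symmL_apply hqt]
        exact t.symm_apply_apply_mk hqt (σ q)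
      change nabla (g • σ) q w - t.symmL ℝ q (mvfderiv I (c (g • σ)) q w) =
        g q • (nabla σ q w - t.symmL ℝ q (mvfderiv I (c σ) q w))
      rw [h2, h3, mvfderiv_fun_smul hg (hc hσ)]
      simp only [_root_.add_apply, _root_.smul_apply,
        ContinuousLinearMap.smulRight_apply, map_add, map_smul, h4]
      module
    · have h1 : c (σ + σ') =ᶠ[nhds q] fun y => c σ y + c σ' y := by
        filter_upwards [hev] with y hy
        exact (t.linear ℝ hy).map_add (σ y) (σ' y)
      have h3 := nabla.isCovariantDerivativeOn.add hσ hσ'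
      change nabla (σ + σ') q w - t.symmL ℝ q (mvfderiv I (c (σ + σ')) q w) =
        nabla σ q w - t.symmL ℝ q (mvfderiv I (c σ) q w) +
        (nabla σ' q w - t.symmL ℝ q (mvfderiv I (c σ') q w))
      rw [hcongr h1, h3, mvfderiv_fun_add (hc hσ) (hc hσ')]
      simp only [_root_.add_apply, map_add]
      abel
  have key : Φ Y = Φ (FiberBundle.extend E (Y q)) :=
    hΦ.pointwise hY (FiberBundle.mdifferentiableAt_extend ..) (by simp)
  have hconst : mvfderiv I (c (FiberBundle.extend E (Y q))) q = 0 := by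
    have h1 : c (FiberBundle.extend E (Y q)) =ᶠ[nhds q] fun _ => c Y q := by
      filter_upwards [hev] with y hy
      simp [c, FiberBundle.extend, ← ht, hy]
    rw [hcongr h1, mvfderiv_const]
  have hchain : mvfderiv J (fun x => c Y (ι x)) p u = mvfderiv I (c Y) q w := by
    have := mfderiv_comp p (hc hY) hι
    simp only [mvfderiv]
    change _ = (mfderiv I 𝓘(ℝ, E) (c Y) q) w
    change (mfderiv J 𝓘(ℝ, E) (c Y ∘ ι) p) u = _
    rw [this]
    rfl
  have key' : nabla Y q w - t.symmL ℝ q (mvfderiv I (c Y) q w)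
      = nabla (FiberBundle.extend E (Y q)) q w := by
    have : Φ (FiberBundle.extend E (Y q)) = nabla (FiberBundle.extend E (Y q)) q w := by
      simp [Φ, hconst]
    rw [← this]; exact key
  change t.symm q (mvfderiv J (fun x => c Y (ι x)) p u)
    + nabla (FiberBundle.extend E (Y q)) q w = nabla Y q w
  rw [← key', hchain, t.symmL_apply hqt]
  abel

variable (I) in
/-- The tangent space `T_p M`, as a subspace of `T_{ι p} N`. -/
def tangentImage (ι : M → N) (p : M) : Submodule ℝ (TangentSpace I (ι p)) :=
  LinearMap.range (mfderiv J I ι p).toLinearMap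

variable [RiemannianBundle (fun x : N => TangentSpace I x)]

instance instFiniteDimensionalTangentSpace (x : N) : FiniteDimensional ℝ (TangentSpace I x) :=
  inferInstanceAs (FiniteDimensional ℝ E)

/-- The component of `w ∈ T_{ι p} N` normal to `M`. -/
def normalPart (ι : M → N) (p : M) (w : TangentSpace I (ι p)) : TangentSpace I (ι p) :=
  (tangentImage I J ι p)ᗮ.starProjection w

/-- The second fundamental form `h(u, v) = (∇_u (dι V))^⊥`, `u, v ∈ T_p M`, where `V` is a
vector field on `M`, smooth around `p`, with `V(p) = v`. -/
def secondFF [IsManifold J ∞ M]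
    (nabla : CovariantDerivative I E (fun x : N => TangentSpace I x))
    (ι : M → N) (p : M) (u v : TangentSpace J p) : TangentSpace I (ι p) :=
  normalPart J ι p (covDerivAlong J nabla ι
    (fun x => mfderiv J I ι x (FiberBundle.extend E' v x)) p u)

/-- The squared norm `∑ i j, ⟨h(e_i, e_j), h(e_i, e_j)⟩` of the second fundamental form at `p`,
for an orthonormal basis `e` of `T_p M`. -/
def secondFFSqNorm [IsManifold J ∞ M]
    (nabla : CovariantDerivative I E (fun x : N => TangentSpace I x))
    (ι : M → N) (p : M) {k : ℕ} (e : Fin k → TangentSpace J p) : ℝ :=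
  ∑ i, ∑ j, inner ℝ (secondFF J nabla ι p (e i) (e j)) (secondFF J nabla ι p (e i) (e j))

/-- The angle between a vector `v` and a subspace `W`: the angle between `v` and its orthogonal
projection to `W` (a right angle when that projection vanishes). -/
def angleWithSubspace {V : Type*} [NormedAddCommGroup V] [InnerProductSpace ℝ V]
    [FiniteDimensional ℝ V] (W : Submodule ℝ V) (v : V) : ℝ :=
  InnerProductGeometry.angle v (W.starProjection v)

/-- `M`, mapped to the almost contact metric manifold `N` by `ι`, is a pointwise semi-slant
submanifold with distributions `D₁`, `D₂` and semi-slant function `θ`: `TM` is the orthogonal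
direct sum of `D₁` and `D₂`, `φ D₁ ⊆ D₁`, and at each `p` the angle between `φ X` and `(D₂)_p`
is defined and equal to `θ p` for all nonzero `X ∈ (D₂)_p`. Tangent vectors of `M` are identified
with their images under `dι`. -/
structure IsPointwiseSemiSlant [IsContMDiffRiemannianBundle I ∞ E
      (fun x : N => TangentSpace I x)]
    (A : AlmostContactMetric I N) (ι : M → N)
    (D₁ D₂ : ∀ p : M, Submodule ℝ (TangentSpace J p)) (θ : M → ℝ) : Prop where
  isCompl : ∀ p, IsCompl (D₁ p) (D₂ p)
  orthogonal : ∀ p, ∀ u ∈ D₁ p, ∀ v ∈ D₂ p,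
    (inner ℝ (mfderiv J I ι p u) (mfderiv J I ι p v) : ℝ) = 0
  phi_invariant : ∀ p, ∀ u ∈ D₁ p, ∃ u' ∈ D₁ p,
    A.phi (ι p) (mfderiv J I ι p u) = mfderiv J I ι p u'
  slant : ∀ p, ∀ v ∈ D₂ p, v ≠ 0 →
    A.phi (ι p) (mfderiv J I ι p v) ≠ 0 ∧
    angleWithSubspace ((D₂ p).map (mfderiv J I ι p).toLinearMap)
      (A.phi (ι p) (mfderiv J I ι p v)) = θ p

/-- The vector `w ∈ T_{ι p} N` lies in `μ_p`, the orthogonal complement of `F D₂` in the normal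
space of `M` at `p`, where `F X` is the normal part of `φ X`. -/
def MemMu [IsContMDiffRiemannianBundle I ∞ E
      (fun x : N => TangentSpace I x)]
    (A : AlmostContactMetric I N) (ι : M → N)
    (D₂ : ∀ p : M, Submodule ℝ (TangentSpace J p)) (p : M) (w : TangentSpace I (ι p)) : Prop :=
  w ∈ (tangentImage I J ι p)ᗮ ∧ ∀ v ∈ D₂ p,
    (inner ℝ (normalPart J ι p (A.phi (ι p) (mfderiv J I ι p v))) w : ℝ) = 0

end Submanifold

section Warped

variable {E₁ : Type*} [NormedAddCommGroup E₁] [NormedSpace ℝ E₁]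
  {H₁ : Type*} [TopologicalSpace H₁] (I₁ : ModelWithCorners ℝ E₁ H₁)
  {B : Type*} [TopologicalSpace B] [ChartedSpace H₁ B]
  [RiemannianBundle (fun x : B => TangentSpace I₁ x)]
  {E₂ : Type*} [NormedAddCommGroup E₂] [NormedSpace ℝ E₂]
  {H₂ : Type*} [TopologicalSpace H₂] (I₂ : ModelWithCorners ℝ E₂ H₂)
  {F : Type*} [TopologicalSpace F] [ChartedSpace H₂ F]
  [RiemannianBundle (fun x : F => TangentSpace I₂ x)]

/-- The metric `g_B + f² g_F` of the warped product `B ×_f F`. -/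
def warpedMetric (f : B → ℝ) (p : B × F) (u v : TangentSpace (I₁.prod I₂) p) : ℝ :=
  inner ℝ (mfderiv (I₁.prod I₂) I₁ Prod.fst p u) (mfderiv (I₁.prod I₂) I₁ Prod.fst p v)
    + f p.1 ^ 2 *
      inner ℝ (mfderiv (I₁.prod I₂) I₂ Prod.snd p u) (mfderiv (I₁.prod I₂) I₂ Prod.snd p v)

/-- The vectors `e i` are orthonormal for the warped product metric. -/
def IsWarpedOrthonormal (f : B → ℝ) (p : B × F) {k : ℕ}
    (e : Fin k → TangentSpace (I₁.prod I₂) p) : Prop :=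
  ∀ i j, warpedMetric I₁ I₂ f p (e i) (e j) = if i = j then 1 else 0

/-- `TB`, as a distribution on `B × F`: the kernel of the differential of the projection to `F`. -/
def tangentBase (p : B × F) : Submodule ℝ (TangentSpace (I₁.prod I₂) p) :=
  LinearMap.ker (mfderiv (I₁.prod I₂) I₂ (Prod.snd : B × F → F) p).toLinearMap

/-- `TF`, as a distribution on `B × F`: the kernel of the differential of the projection to `B`. -/
def tangentFibre (p : B × F) : Submodule ℝ (TangentSpace (I₁.prod I₂) p) :=
  LinearMap.ker (mfderiv (I₁.prod I₂) I₁ (Prod.fst : B × F → B) p).toLinearMap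

/-- The gradient at `b` of a function `k` on the Riemannian manifold `B`. -/
def grad [FiniteDimensional ℝ E₁] (k : B → ℝ) (b : B) : TangentSpace I₁ b :=
  haveI : CompleteSpace (TangentSpace I₁ b) := FiniteDimensional.complete ℝ _
  (InnerProductSpace.toDual ℝ (TangentSpace I₁ b)).symm (mvfderiv I₁ k b)

end Warped

end

end SemiSlant

set_option linter.unusedSectionVars false

/-! Write `T Z` and `F Z` for the tangential and normal parts of `φ Z`. The theorem is a computation
of all components of `h` in one adapted frame. Take an orthonormal frame `x_i` of `TB` and `z_a` of
`TF`. Since `|F Z| = sin θ |Z|` on the fibre, the vectors `F z_a / sin θ` are orthonormal, and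
together with `ξ` they are normal to `M`. The relation `n = m₁ + 2 m₂` makes `x_i, z_a, F z_a / sin
θ, ξ` a full orthonormal basis of `TN`, so the normal space is exactly `F D₂ ⊕ ℝ ξ`.

Both cases obey `(∇_X φ) Y = c (g(φ X, Y) ξ - η(Y) φ X)`, with `c = 1` for Kenmotsu and `c = 0` for
cosymplectic (`HasKenmotsuFactor`). For cosymplectic manifolds this is the classical fact `∇φ = 0`,
whose algebraic core is `eq_zero_of_cosymplectic_algebra`.

Differentiating `⟨V, ξ⟩ = 0` gives `⟨h(U, V), ξ⟩ = -c ⟨U, V⟩` (`inner_secondFF_xi`). Differentiating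
`⟨φ Y, Z⟩ = 0` with `Y` in `TB` and `Z` in `TF` expresses `⟨h(U, Y), F Z⟩` through tangential
derivatives (`inner_secondFF_base`). In a warped product these are known: `TB` is totally geodesic
and `∇_Z X = X(ln f) Z` (`tangentialCov_base_base_fibre`, `tangentialCov_fibre_base_fibre`). Hence
`h(x_i, x_j)` has only a `ξ` component, and `⟨h(z_a, x_i), F z_b⟩ = -(φ x_i)(ln f) δ_ab - x_i(ln f)
⟨z_a, T z_b⟩`.

Squaring and summing, the base block gives `2 m₁ c²`. The two mixed blocks give `2 · 2 m₂ · csc² θ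
(1 + cos² θ) |∇ ln f|²`, because `T` is skew with `|T Z| = cos θ |Z|` and `φ x_i` is again an
orthonormal frame of `TB`. What remains is `∑ |h(z_a, z_b)|²`: it is nonnegative, and its vanishing
is the equality condition (`exists_secondFFSqNorm_eq`). -/

namespace SemiSlant

noncomputable section

/-! ### Vector fields along a map and their covariant derivative. -/

section Along

variable {E : Type*} [NormedAddCommGroup E] [NormedSpace ℝ E] [FiniteDimensional ℝ E]
  {H : Type*} [TopologicalSpace H] {I : ModelWithCorners ℝ E H}
  {N : Type*} [TopologicalSpace N] [ChartedSpace H N] [IsManifold I ∞ N]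
  {E' : Type*} [NormedAddCommGroup E'] [NormedSpace ℝ E']
  {H' : Type*} [TopologicalSpace H'] {J : ModelWithCorners ℝ E' H'}
  {M : Type*} [TopologicalSpace M] [ChartedSpace H' M]

/-- The vector field `X` is differentiable at the point `x`. -/
abbrev DiffFieldAt (X : ∀ x : N, TangentSpace I x) (x : N) : Prop :=
  MDifferentiableAt I I.tangent (fun y => (TotalSpace.mk' E y (X y) : TangentBundle I N)) x

theorem SmoothFieldAt.diffFieldAt {X : ∀ x : N, TangentSpace I x} {x : N}
    (h : SmoothFieldAt X x) : DiffFieldAt X x :=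
  h.mdifferentiableAt (by simp)

theorem smoothFieldAt_extend {x : N} (v : TangentSpace I x) :
    SmoothFieldAt (FiberBundle.extend E v) x := by
  have hx := FiberBundle.mem_baseSet_trivializationAt' (F := E)
    (E := fun x : N => TangentSpace I x) x
  unfold SmoothFieldAt
  rw [contMDiffAt_section]
  refine (contMDiffAt_const (c := (trivializationAt E (fun x : N => TangentSpace I x) x
    ⟨x, v⟩).2)).congr_of_eventuallyEq ?_
  filter_upwards [(trivializationAt E (fun x : N => TangentSpace I x) x).open_baseSet.mem_nhds hx]
    with y hy
  have h := congrArg Prod.snd (Trivialization.apply_mk_symm _ hy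
    (trivializationAt E (fun x : N => TangentSpace I x) x ⟨x, v⟩).2)
  exact h

variable (J) in
/-- The vector field `V` along `ι` is differentiable at `p`. -/
abbrev DiffAlongAt (ι : M → N) (V : ∀ x : M, TangentSpace I (ι x)) (p : M) : Prop :=
  MDifferentiableAt J I.tangent (fun x => (TotalSpace.mk' E (ι x) (V x) : TangentBundle I N)) p

/-- The components of a vector field along `ι` in the preferred trivialization at `ι p`. -/
def alongCoord (ι : M → N) (V : ∀ x : M, TangentSpace I (ι x)) (p : M) (x : M) : E :=
  (trivializationAt E (fun x : N => TangentSpace I x) (ι p) (TotalSpace.mk' E (ι x) (V x))).2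

theorem diffAlongAt_iff {ι : M → N} {p : M} (hι : MDifferentiableAt J I ι p)
    {V : ∀ x : M, TangentSpace I (ι x)} :
    DiffAlongAt J ι V p ↔ MDifferentiableAt J 𝓘(ℝ, E) (alongCoord ι V p) p := by
  unfold DiffAlongAt
  rw [mdifferentiableAt_totalSpace]
  exact ⟨fun h => h.2, fun h => ⟨hι, h⟩⟩

theorem DiffFieldAt.along {ι : M → N} {p : M} (hι : MDifferentiableAt J I ι p)
    {Y : ∀ y : N, TangentSpace I y} (hY : DiffFieldAt Y (ι p)) :
    DiffAlongAt J ι (fun x => Y (ι x)) p :=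
  MDifferentiableAt.comp (I' := I) p hY hι

theorem eventually_mem_baseSet {ι : M → N} {p : M} (hι : MDifferentiableAt J I ι p) :
    ∀ᶠ x in nhds p, ι x ∈ (trivializationAt E (fun x : N => TangentSpace I x) (ι p)).baseSet :=
  hι.continuousAt.eventually_mem
    ((trivializationAt E (fun x : N => TangentSpace I x) (ι p)).open_baseSet.mem_nhds
      (FiberBundle.mem_baseSet_trivializationAt' _))

theorem alongCoord_add {ι : M → N} {p : M} (hι : MDifferentiableAt J I ι p)
    (V W : ∀ x : M, TangentSpace I (ι x)) :
    alongCoord ι (V + W) p =ᶠ[nhds p] alongCoord ι V p + alongCoord ι W p := by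
  filter_upwards [eventually_mem_baseSet hι] with x hx
  exact ((trivializationAt E (fun x : N => TangentSpace I x) (ι p)).linear ℝ hx).map_add _ _

theorem alongCoord_smul {ι : M → N} {p : M} (hι : MDifferentiableAt J I ι p) (g : M → ℝ)
    (V : ∀ x : M, TangentSpace I (ι x)) :
    alongCoord ι (fun x => g x • V x) p =ᶠ[nhds p] fun x => g x • alongCoord ι V p x := by
  filter_upwards [eventually_mem_baseSet hι] with x hx
  exact ((trivializationAt E (fun x : N => TangentSpace I x) (ι p)).linear ℝ hx).map_smul _ _

theorem DiffAlongAt.add {ι : M → N} {p : M} (hι : MDifferentiableAt J I ι p)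
    {V W : ∀ x : M, TangentSpace I (ι x)} (hV : DiffAlongAt J ι V p) (hW : DiffAlongAt J ι W p) :
    DiffAlongAt J ι (V + W) p := by
  rw [diffAlongAt_iff hι] at *
  exact (hV.add hW).congr_of_eventuallyEq (alongCoord_add hι V W)

theorem DiffAlongAt.smul {ι : M → N} {p : M} (hι : MDifferentiableAt J I ι p)
    {g : M → ℝ} {V : ∀ x : M, TangentSpace I (ι x)} (hg : MDifferentiableAt J 𝓘(ℝ, ℝ) g p)
    (hV : DiffAlongAt J ι V p) :
    DiffAlongAt J ι (fun x => g x • V x) p := by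
  rw [diffAlongAt_iff hι] at *
  exact (hg.smul hV).congr_of_eventuallyEq (alongCoord_smul hι g V)

/-- A property of germs of differentiable vector fields along `ι` that holds for restrictions of
smooth vector fields of `N` and is stable under sums and products with functions always holds. -/
theorem along_induction {ι : M → N} {p : M} (hι : MDifferentiableAt J I ι p)
    {P : (∀ x : M, TangentSpace I (ι x)) → Prop}
    (hcomp : ∀ Y : ∀ y : N, TangentSpace I y, SmoothFieldAt Y (ι p) → P (fun x => Y (ι x)))
    (hadd : ∀ V W, DiffAlongAt J ι V p → DiffAlongAt J ι W p → P V → P W → P (V + W))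
    (hsmul : ∀ (g : M → ℝ) V, MDifferentiableAt J 𝓘(ℝ, ℝ) g p → DiffAlongAt J ι V p → P V →
      P (fun x => g x • V x))
    (hcongr : ∀ V W, (∀ᶠ x in nhds p, V x = W x) → P V → P W)
    {V : ∀ x : M, TangentSpace I (ι x)} (hV : DiffAlongAt J ι V p) : P V := by
  classical
  set t := trivializationAt E (fun x : N => TangentSpace I x) (ι p) with ht
  have hp : ι p ∈ t.baseSet := FiberBundle.mem_baseSet_trivializationAt' _
  let b := Module.finBasis ℝ E
  -- The `Y i` form a local frame with constant coefficients in the trivialization; near `p` the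
  -- field `V` is the combination of the `Y i ∘ ι` with its own coordinates `c i`.
  let Y : Fin (Module.finrank ℝ E) → ∀ y : N, TangentSpace I y := fun i =>
    FiberBundle.extend E (t.symm (ι p) (b i))
  have hYs : ∀ i, SmoothFieldAt (Y i) (ι p) := fun i => smoothFieldAt_extend _
  let c : Fin (Module.finrank ℝ E) → M → ℝ := fun i x => b.repr (alongCoord ι V p x) i
  have hc : ∀ i, MDifferentiableAt J 𝓘(ℝ, ℝ) (c i) p := fun i => by
    have h1 := (diffAlongAt_iff hι).1 hV
    exact (LinearMap.toContinuousLinearMap (b.coord i)).mdifferentiableAt.comp p h1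
  -- Differentiability of the partial sums is carried along because `hadd` asks for it.
  have key : ∀ s : Finset (Fin (Module.finrank ℝ E)),
      P (fun x => ∑ i ∈ s, c i x • Y i (ι x)) ∧
      DiffAlongAt J ι (fun x => ∑ i ∈ s, c i x • Y i (ι x)) p := by
    intro s
    induction s using Finset.induction_on with
    | empty =>
      have h0 : SmoothFieldAt (fun y : N => (0 : TangentSpace I y)) (ι p) :=
        (contMDiff_zeroSection ℝ (fun x : N => TangentSpace I x)).contMDiffAt
      simp only [Finset.sum_empty]
      exact ⟨hcomp _ h0, DiffFieldAt.along hι h0.diffFieldAt⟩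
    | insert a s ha ih =>
      have hYa : DiffAlongAt J ι (fun x => Y a (ι x)) p := DiffFieldAt.along hι (hYs a).diffFieldAt
      have h1 : DiffAlongAt J ι (fun x => c a x • Y a (ι x)) p := DiffAlongAt.smul hι (hc a) hYa
      have heq : (fun x => ∑ i ∈ insert a s, c i x • Y i (ι x)) =
          (fun x => c a x • Y a (ι x)) + fun x => ∑ i ∈ s, c i x • Y i (ι x) := by
        funext x
        simp [Finset.sum_insert ha]
      rw [heq]
      exact ⟨hadd _ _ h1 ih.2 (hsmul _ _ (hc a) hYa (hcomp _ (hYs a))) ih.1,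
        DiffAlongAt.add hι h1 ih.2⟩
  refine hcongr _ _ ?_ (key Finset.univ).1
  filter_upwards [eventually_mem_baseSet hι] with x hx
  have h2 : ∀ i, Y i (ι x) = t.symmL ℝ (ι x) (b i) := fun i => by
    have : (t ⟨ι p, t.symm (ι p) (b i)⟩).2 = b i := by
      rw [t.apply_mk_symm hp]
    simp only [Y, FiberBundle.extend, ← ht, this]
    rw [t.symmL_apply hx]
  simp only [h2, ← map_smul, ← map_sum]
  have h3 : ∑ i, c i x • b i = alongCoord ι V p x := b.sum_repr _
  rw [h3, t.symmL_apply hx]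
  exact t.symm_apply_apply_mk hx (V x)

section Cov

variable (nabla : CovariantDerivative I E (fun x : N => TangentSpace I x))

theorem mvfderiv_congr_of_eventuallyEq {F : Type*} [NormedAddCommGroup F] [NormedSpace ℝ F]
    {a b : M → F} {p : M} (hab : a =ᶠ[nhds p] b) : mvfderiv J a p = mvfderiv J b p := by
  ext v
  simp only [mvfderiv, hab.mfderiv_eq]
  rfl

theorem covDerivAlong_congr {ι : M → N} {p : M} {V W : ∀ x : M, TangentSpace I (ι x)}
    (h : ∀ᶠ x in nhds p, V x = W x) (u : TangentSpace J p) :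
    covDerivAlong J nabla ι V p u = covDerivAlong J nabla ι W p u := by
  have h1 : alongCoord ι V p =ᶠ[nhds p] alongCoord ι W p := by
    filter_upwards [h] with x hx
    simp [alongCoord, hx]
  have h2 := mvfderiv_congr_of_eventuallyEq (J := J) h1
  change _ + _ = _ + _
  rw [h.self_of_nhds]
  change (trivializationAt E (fun x : N => TangentSpace I x) (ι p)).symm (ι p)
    (mvfderiv J (alongCoord ι V p) p u) + _ = _
  rw [h2]
  rfl

theorem covDerivAlong_eq {ι : M → N} {p : M} (V : ∀ x : M, TangentSpace I (ι x))
    (u : TangentSpace J p) :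
    covDerivAlong J nabla ι V p u =
      (trivializationAt E (fun x : N => TangentSpace I x) (ι p)).symmL ℝ (ι p)
        (mvfderiv J (alongCoord ι V p) p u)
      + nabla (FiberBundle.extend E (V p)) (ι p) (mfderiv J I ι p u) := by
  rw [Trivialization.symmL_apply _ (FiberBundle.mem_baseSet_trivializationAt' _)]
  rfl

theorem covDerivAlong_add_vec {ι : M → N} {p : M} (V : ∀ x : M, TangentSpace I (ι x))
    (u v : TangentSpace J p) : covDerivAlong J nabla ι V p (u + v) =
      covDerivAlong J nabla ι V p u + covDerivAlong J nabla ι V p v := by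
  simp only [covDerivAlong_eq, map_add]
  abel

theorem covDerivAlong_smul_vec {ι : M → N} {p : M} (V : ∀ x : M, TangentSpace I (ι x))
    (a : ℝ) (u : TangentSpace J p) : covDerivAlong J nabla ι V p (a • u) =
      a • covDerivAlong J nabla ι V p u := by
  simp only [covDerivAlong_eq, map_smul, smul_add]

/-- Over the base set of the trivialization `FiberBundle.extend` is linear in the vector, and a
covariant derivative depends only on the germ. This gives linearity in `V p` of the second term of
`covDerivAlong`. -/
theorem nabla_extend_add {q : N} (a b : TangentSpace I q) :
    nabla (FiberBundle.extend E (a + b)) q =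
      nabla (FiberBundle.extend E a) q + nabla (FiberBundle.extend E b) q := by
  have h := nabla.isCovariantDerivativeOnUniv.add (smoothFieldAt_extend a).diffFieldAt
    (smoothFieldAt_extend b).diffFieldAt
  rw [← h]
  refine nabla.isCovariantDerivativeOnUniv.congr_of_eventuallyEq
    (smoothFieldAt_extend _).diffFieldAt
    (mdifferentiableAt_add_section (smoothFieldAt_extend a).diffFieldAt
      (smoothFieldAt_extend b).diffFieldAt) Filter.univ_mem ?_
  set t := trivializationAt E (fun x : N => TangentSpace I x) q with ht
  have hq : q ∈ t.baseSet := FiberBundle.mem_baseSet_trivializationAt' _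
  filter_upwards [t.open_baseSet.mem_nhds hq] with y hy
  have h1 : (t ⟨q, a + b⟩).2 = (t ⟨q, a⟩).2 + (t ⟨q, b⟩).2 := (t.linear ℝ hq).map_add a b
  simp only [FiberBundle.extend, ← ht, h1, Pi.add_apply]
  simp only [← t.symmL_apply (R := ℝ) hy, map_add]

theorem nabla_extend_smul {q : N} (r : ℝ) (a : TangentSpace I q) :
    nabla (FiberBundle.extend E (r • a)) q = r • nabla (FiberBundle.extend E a) q := by
  have h := nabla.isCovariantDerivativeOnUniv.smul_const r (smoothFieldAt_extend a).diffFieldAt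
  rw [← h]
  refine nabla.isCovariantDerivativeOnUniv.congr_of_eventuallyEq
    (smoothFieldAt_extend _).diffFieldAt
    (mdifferentiableAt_const.smul_section (smoothFieldAt_extend a).diffFieldAt)
    Filter.univ_mem ?_
  set t := trivializationAt E (fun x : N => TangentSpace I x) q with ht
  have hq : q ∈ t.baseSet := FiberBundle.mem_baseSet_trivializationAt' _
  filter_upwards [t.open_baseSet.mem_nhds hq] with y hy
  have h1 : (t ⟨q, r • a⟩).2 = r • (t ⟨q, a⟩).2 := (t.linear ℝ hq).map_smul r a
  simp only [FiberBundle.extend, ← ht, h1, Pi.smul_apply]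
  simp only [← t.symmL_apply (R := ℝ) hy, map_smul]

theorem covDerivAlong_add {ι : M → N} {p : M} (hι : MDifferentiableAt J I ι p)
    {V W : ∀ x : M, TangentSpace I (ι x)} (hV : DiffAlongAt J ι V p) (hW : DiffAlongAt J ι W p)
    (u : TangentSpace J p) : covDerivAlong J nabla ι (V + W) p u =
      covDerivAlong J nabla ι V p u + covDerivAlong J nabla ι W p u := by
  have hV' := (diffAlongAt_iff hι).1 hV
  have hW' := (diffAlongAt_iff hι).1 hW
  simp only [covDerivAlong_eq, mvfderiv_congr_of_eventuallyEq (alongCoord_add hι V W),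
    mvfderiv_add hV' hW', Pi.add_apply, nabla_extend_add, _root_.add_apply, map_add]
  abel

theorem covDerivAlong_smul {ι : M → N} {p : M} (hι : MDifferentiableAt J I ι p)
    {g : M → ℝ} {V : ∀ x : M, TangentSpace I (ι x)} (hg : MDifferentiableAt J 𝓘(ℝ, ℝ) g p)
    (hV : DiffAlongAt J ι V p)
    (u : TangentSpace J p) : covDerivAlong J nabla ι (fun x => g x • V x) p u =
      g p • covDerivAlong J nabla ι V p u + mvfderiv J g p u • V p := by
  have hV' := (diffAlongAt_iff hι).1 hV
  have hp := FiberBundle.mem_baseSet_trivializationAt' (F := E)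
    (E := fun x : N => TangentSpace I x) (ι p)
  have h4 : (trivializationAt E (fun x : N => TangentSpace I x) (ι p)).symmL ℝ (ι p)
      (alongCoord ι V p p) = V p := by
    rw [Trivialization.symmL_apply _ hp]
    exact Trivialization.symm_apply_apply_mk _ hp (V p)
  simp only [covDerivAlong_eq, mvfderiv_congr_of_eventuallyEq (alongCoord_smul hι g V),
    mvfderiv_fun_smul hg hV', nabla_extend_smul, _root_.add_apply, _root_.smul_apply, map_add,
    ContinuousLinearMap.smulRight_apply, map_smul, h4]
  module

end Cov

end Along

/-! ### Compatibility of the derivative along a map with the metric and with `φ`. -/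

section Riemannian

variable {E : Type*} [NormedAddCommGroup E] [NormedSpace ℝ E] [FiniteDimensional ℝ E]
  {H : Type*} [TopologicalSpace H] {I : ModelWithCorners ℝ E H}
  {N : Type*} [TopologicalSpace N] [ChartedSpace H N] [IsManifold I ∞ N]
  [RiemannianBundle (fun x : N => TangentSpace I x)]
  [IsContMDiffRiemannianBundle I ∞ E (fun x : N => TangentSpace I x)]
  {E' : Type*} [NormedAddCommGroup E'] [NormedSpace ℝ E']
  {H' : Type*} [TopologicalSpace H'] {J : ModelWithCorners ℝ E' H'}
  {M : Type*} [TopologicalSpace M] [ChartedSpace H' M]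
  {nabla : CovariantDerivative I E (fun x : N => TangentSpace I x)}

theorem DiffAlongAt.inner {ι : M → N} {p : M}
    {V W : ∀ x : M, TangentSpace I (ι x)} (hV : DiffAlongAt J ι V p) (hW : DiffAlongAt J ι W p) :
    MDifferentiableAt J 𝓘(ℝ, ℝ) (fun x => (inner ℝ (V x) (W x) : ℝ)) p :=
  MDifferentiableAt.inner_bundle (IB := I) (F := E) (E := fun x : N => TangentSpace I x) hV hW

theorem DiffFieldAt.inner {x : N}
    {V W : ∀ x : N, TangentSpace I x} (hV : DiffFieldAt V x) (hW : DiffFieldAt W x) :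
    MDifferentiableAt I 𝓘(ℝ, ℝ) (fun x => (inner ℝ (V x) (W x) : ℝ)) x :=
  MDifferentiableAt.inner_bundle (IB := I) (F := E) (E := fun x : N => TangentSpace I x)
    (b := fun x => x) hV hW

/-- The covariant derivative along a map is compatible with the metric. -/
theorem covDerivAlong_inner (hnabla : IsLeviCivita nabla)
    {ι : M → N} {p : M} (hι : MDifferentiableAt J I ι p)
    {V W : ∀ x : M, TangentSpace I (ι x)} (hV : DiffAlongAt J ι V p) (hW : DiffAlongAt J ι W p)
    (u : TangentSpace J p) :
    mvfderiv J (fun x => (inner ℝ (V x) (W x) : ℝ)) p u =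
      inner ℝ (covDerivAlong J nabla ι V p u) (W p) +
        inner ℝ (V p) (covDerivAlong J nabla ι W p u) := by
  -- Both sides are additive and obey the same Leibniz rule in each argument. Inducting on `V` and
  -- then on `W` leaves two restrictions of ambient fields, where the claim is metric compatibility
  -- and the chain rule.
  refine along_induction hι (P := fun V => mvfderiv J (fun x => (inner ℝ (V x) (W x) : ℝ)) p u =
      inner ℝ (covDerivAlong J nabla ι V p u) (W p) +
        inner ℝ (V p) (covDerivAlong J nabla ι W p u)) ?_ ?_ ?_ ?_ hV
  · intro Y hY
    have hYa := DiffFieldAt.along hι hY.diffFieldAt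
    refine along_induction hι (P := fun W => mvfderiv J
      (fun x => (inner ℝ (Y (ι x)) (W x) : ℝ)) p u =
      inner ℝ (covDerivAlong J nabla ι (fun x => Y (ι x)) p u) (W p) +
        inner ℝ (Y (ι p)) (covDerivAlong J nabla ι W p u)) ?_ ?_ ?_ ?_ hW
    · intro Z hZ
      rw [covDerivAlong_comp J nabla hι hY.diffFieldAt, covDerivAlong_comp J nabla hι hZ.diffFieldAt,
        ← hnabla.metric _ _ _ _ hY.diffFieldAt hZ.diffFieldAt]
      have h1 := mvfderiv_comp p (DiffFieldAt.inner hY.diffFieldAt hZ.diffFieldAt) hι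
      exact congrArg (fun L => L u) h1
    · intro W₁ W₂ h1 h2 e1 e2
      simp only [Pi.add_apply, inner_add_right, covDerivAlong_add nabla hι h1 h2]
      rw [mvfderiv_fun_add (DiffAlongAt.inner hYa h1) (DiffAlongAt.inner hYa h2)]
      simp only [_root_.add_apply, e1, e2]
      ring
    · intro g W₁ hg h1 e1
      simp only [covDerivAlong_smul nabla hι hg h1, inner_smul_right, inner_add_right]
      rw [mvfderiv_fun_mul hg (DiffAlongAt.inner hYa h1)]
      simp only [_root_.add_apply, _root_.smul_apply, e1, smul_eq_mul]
      ring
    · intro W₁ W₂ h e1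
      rw [← covDerivAlong_congr nabla h, ← h.self_of_nhds, ← e1]
      rw [mvfderiv_congr_of_eventuallyEq (J := J)]
      filter_upwards [h] with x hx
      rw [hx]
  · intro V₁ V₂ h1 h2 e1 e2
    simp only [Pi.add_apply, inner_add_left, covDerivAlong_add nabla hι h1 h2]
    rw [mvfderiv_fun_add (DiffAlongAt.inner h1 hW) (DiffAlongAt.inner h2 hW)]
    simp only [_root_.add_apply, e1, e2]
    ring
  · intro g V₁ hg h1 e1
    simp only [covDerivAlong_smul nabla hι hg h1, real_inner_smul_left, inner_add_left]
    rw [mvfderiv_fun_mul hg (DiffAlongAt.inner h1 hW)]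
    simp only [_root_.add_apply, _root_.smul_apply, e1, smul_eq_mul]
    ring
  · intro V₁ V₂ h e1
    rw [← covDerivAlong_congr nabla h, ← h.self_of_nhds, ← e1]
    rw [mvfderiv_congr_of_eventuallyEq (J := J)]
    filter_upwards [h] with x hx
    rw [hx]

variable (A : AlmostContactMetric I N)

theorem DiffAlongAt.phi {ι : M → N} {p : M} (hι : MDifferentiableAt J I ι p)
    {V : ∀ x : M, TangentSpace I (ι x)} (hV : DiffAlongAt J ι V p) :
    DiffAlongAt J ι (fun x => A.phi (ι x) (V x)) p := by
  have h1 := (A.phi_smooth.mdifferentiableAt (x := ι p) (by simp)).comp p hι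
  exact MDifferentiableAt.clm_bundle_apply (F₁ := E) (F₂ := E)
    (E₁ := fun x : N => TangentSpace I x) (E₂ := fun x : N => TangentSpace I x) h1 hV

theorem SmoothFieldAt.phi {Y : ∀ y : N, TangentSpace I y} {x : N} (hY : SmoothFieldAt Y x) :
    SmoothFieldAt (A.phiField Y) x :=
  ContMDiffAt.clm_bundle_apply (F₁ := E) (F₂ := E) (b := fun x => x)
    (E₁ := fun x : N => TangentSpace I x) (E₂ := fun x : N => TangentSpace I x)
    A.phi_smooth.contMDiffAt hY

/-- The covariant derivative of `φ` is `c` times that of a Kenmotsu manifold: `c = 1` is the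
Kenmotsu condition and `c = 0` is `∇φ = 0`. -/
def HasKenmotsuFactor (nabla : CovariantDerivative I E (fun x : N => TangentSpace I x))
    (c : ℝ) : Prop :=
  ∀ x (u : TangentSpace I x) (Y : ∀ x : N, TangentSpace I x), SmoothFieldAt Y x →
    nabla (A.phiField Y) x u - A.phi x (nabla Y x u)
      = c • ((inner ℝ (A.phi x u) (Y x) : ℝ) • A.xi x - A.eta x (Y x) • A.phi x u)

variable {A}

/-- The Leibniz term `u(g) φ V` appears on both sides when `V` is multiplied by `g`, so the identity
passes from ambient fields to all differentiable fields along `ι`. -/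
theorem HasKenmotsuFactor.covDerivAlong_phi {c : ℝ} (hc : HasKenmotsuFactor A nabla c)
    {ι : M → N} {p : M} (hι : MDifferentiableAt J I ι p)
    {V : ∀ x : M, TangentSpace I (ι x)} (hV : DiffAlongAt J ι V p) (u : TangentSpace J p) :
    covDerivAlong J nabla ι (fun x => A.phi (ι x) (V x)) p u =
      A.phi (ι p) (covDerivAlong J nabla ι V p u) +
      c • ((inner ℝ (A.phi (ι p) (mfderiv J I ι p u)) (V p) : ℝ) • A.xi (ι p)
        - A.eta (ι p) (V p) • A.phi (ι p) (mfderiv J I ι p u)) := by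
  refine along_induction hι (P := fun V => covDerivAlong J nabla ι (fun x => A.phi (ι x) (V x)) p u =
      A.phi (ι p) (covDerivAlong J nabla ι V p u) +
      c • ((inner ℝ (A.phi (ι p) (mfderiv J I ι p u)) (V p) : ℝ) • A.xi (ι p)
        - A.eta (ι p) (V p) • A.phi (ι p) (mfderiv J I ι p u))) ?_ ?_ ?_ ?_ hV
  · intro Y hY
    rw [covDerivAlong_comp J nabla hι hY.diffFieldAt]
    have h1 := covDerivAlong_comp J nabla hι (hY.phi A).diffFieldAt u
    have h2 := hc _ (mfderiv J I ι p u) Y hY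
    rw [← h2, ← h1]
    simp only [add_sub_cancel]
    rfl
  · intro V₁ V₂ h1 h2 e1 e2
    have h3 := covDerivAlong_add nabla hι (h1.phi A hι) (h2.phi A hι) u
    have h4 : (fun x => A.phi (ι x) ((V₁ + V₂) x)) =
      (fun x => A.phi (ι x) (V₁ x)) + fun x => A.phi (ι x) (V₂ x) := by
      funext x; simp
    rw [h4, h3, e1, e2, covDerivAlong_add nabla hι h1 h2]
    simp only [Pi.add_apply, map_add, inner_add_right]
    module
  · intro g V₁ hg h1 e1
    have h3 := covDerivAlong_smul nabla hι hg (h1.phi A hι) u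
    simp only [map_smul]
    rw [h3, e1, covDerivAlong_smul nabla hι hg h1]
    simp only [map_add, map_smul, inner_smul_right]
    module
  · intro V₁ V₂ h e1
    rw [← covDerivAlong_congr nabla h, ← h.self_of_nhds, ← e1]
    refine (covDerivAlong_congr nabla ?_ u).symm
    filter_upwards [h] with x hx
    rw [hx]

end Riemannian

/-! ### Commuting coordinate fields. -/

section Bracket

variable {E : Type*} [NormedAddCommGroup E] [NormedSpace ℝ E] [FiniteDimensional ℝ E]
  {H : Type*} [TopologicalSpace H] {I : ModelWithCorners ℝ E H}
  {N : Type*} [TopologicalSpace N] [ChartedSpace H N] [IsManifold I ∞ N]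

/-- Near `q`, `extend v` is the coordinate vector field with constant coefficients `v`. -/
theorem extend_eq_mfderivWithin {q x : N} (v : TangentSpace I q)
    (hx : x ∈ (chartAt H q).source) :
    FiberBundle.extend E v x =
      mfderivWithin 𝓘(ℝ, E) I (extChartAt I q).symm (Set.range I) (extChartAt I q x) v := by
  have : IsManifold I 1 N := IsManifold.of_le (n := ∞) (by simp)
  have hq : q ∈ (chartAt H q).source := mem_chart_source H q
  have h1 := TangentBundle.symmL_trivializationAt (I := I) hx
  have h2 := TangentBundle.continuousLinearMapAt_trivializationAt (I := I) hq
  have hxb : x ∈ (trivializationAt E (fun x : N => TangentSpace I x) q).baseSet := by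
    rw [TangentBundle.trivializationAt_baseSet]; exact hx
  have hqb : q ∈ (trivializationAt E (fun x : N => TangentSpace I x) q).baseSet := by
    rw [TangentBundle.trivializationAt_baseSet]; exact hq
  have h3 : (trivializationAt E (fun x : N => TangentSpace I x) q ⟨q, v⟩).2 = v := by
    have h4 : (trivializationAt E (fun x : N => TangentSpace I x) q).continuousLinearMapAt ℝ q v
        = v := by
      rw [h2, mfderiv_extChartAt_self]; rfl
    rw [Trivialization.continuousLinearMapAt_apply,
      Trivialization.coe_linearMapAt_of_mem _ hqb] at h4
    exact h4
  have h5 : FiberBundle.extend E v x =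
      (trivializationAt E (fun x : N => TangentSpace I x) q).symmL ℝ x v := by
    exact (congrArg _ h3).trans (Trivialization.symmL_apply (R := ℝ) _ hxb ..).symm
  exact h5.trans (congrArg (fun L : E →L[ℝ] E => L v) h1)

/-- Pulled back through the chart at `q`, both fields are constant near the point, so their bracket
vanishes. -/
theorem mlieBracket_extend {q : N} (a b : TangentSpace I q) :
    VectorField.mlieBracket I (FiberBundle.extend E a) (FiberBundle.extend E b) q = 0 := by
  have : IsManifold I 1 N := IsManifold.of_le (n := ∞) (by simp)
  have hev : ∀ v : TangentSpace I q,
      VectorField.mpullbackWithin 𝓘(ℝ, E) I (extChartAt I q).symm (FiberBundle.extend E v)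
        (Set.range I) =ᶠ[nhdsWithin (extChartAt I q q) ((extChartAt I q).symm ⁻¹' Set.univ ∩
          Set.range I)] fun _ => (v : E) := by
    intro v
    have : (extChartAt I q).target ∈ nhdsWithin (extChartAt I q q)
        ((extChartAt I q).symm ⁻¹' Set.univ ∩ Set.range I) := by
      simpa using extChartAt_target_mem_nhdsWithin q
    filter_upwards [this] with y hy
    have hx : (extChartAt I q).symm y ∈ (chartAt H q).source := by
      simpa using (extChartAt I q).map_target hy
    have hinv := isInvertible_mfderivWithin_extChartAt_symm (I := I) hy
    rw [VectorField.mpullbackWithin_apply, extend_eq_mfderivWithin v hx,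
      (extChartAt I q).right_inv hy]
    exact congrArg (fun L : E →L[ℝ] E => L v) hinv.inverse_comp_self
  have hmem : extChartAt I q q ∈ (extChartAt I q).symm ⁻¹' Set.univ ∩ Set.range I := by
    simp
  have h0 := (hev a).lieBracketWithin_vectorField_eq_of_mem (𝕜 := ℝ) (hev b) hmem
  have h1 : ∀ a b : E, VectorField.lieBracketWithin ℝ (fun _ : E => a) (fun _ => b)
      ((extChartAt I q).symm ⁻¹' Set.univ ∩ Set.range I) (extChartAt I q q) = 0 := by
    simp [VectorField.lieBracketWithin]
  change (mfderiv I 𝓘(ℝ, E) (extChartAt I q) q).inverse _ = 0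
  exact (congrArg _ (h0.trans (h1 a b))).trans (map_zero _)

variable [RiemannianBundle (fun x : N => TangentSpace I x)]
  [IsContMDiffRiemannianBundle I ∞ E (fun x : N => TangentSpace I x)]
  {nabla : CovariantDerivative I E (fun x : N => TangentSpace I x)}

theorem IsLeviCivita.mlieBracket_eq (hnabla : IsLeviCivita nabla) {x : N}
    {X Y : ∀ y : N, TangentSpace I y} (hX : DiffFieldAt X x) (hY : DiffFieldAt Y x) :
    VectorField.mlieBracket I X Y x = nabla Y x (X x) - nabla X x (Y x) :=
  (nabla.torsion_eq_zero_iff.1 hnabla.torsion_eq_zero hX hY).symm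

/-- Symmetry of the Christoffel symbols: the torsion vanishes and the two coordinate fields commute
at `q`. -/
theorem nabla_extend_comm (hnabla : IsLeviCivita nabla) {q : N} (a b : TangentSpace I q) :
    nabla (FiberBundle.extend E a) q b = nabla (FiberBundle.extend E b) q a := by
  have h := hnabla.mlieBracket_eq (smoothFieldAt_extend a).diffFieldAt
    (smoothFieldAt_extend b).diffFieldAt
  rw [mlieBracket_extend, FiberBundle.extend_apply_self, FiberBundle.extend_apply_self] at h
  exact (sub_eq_zero.1 h.symm).symm

end Bracket

/-! ### Symmetry of the second derivative of the immersion. -/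

section Symmetry

variable {E : Type*} [NormedAddCommGroup E] [NormedSpace ℝ E] [FiniteDimensional ℝ E]
  {H : Type*} [TopologicalSpace H] {I : ModelWithCorners ℝ E H}
  {N : Type*} [TopologicalSpace N] [ChartedSpace H N] [IsManifold I ∞ N]
  {E' : Type*} [NormedAddCommGroup E'] [NormedSpace ℝ E'] [FiniteDimensional ℝ E']
  {H' : Type*} [TopologicalSpace H'] {J : ModelWithCorners ℝ E' H'} [J.Boundaryless]
  {M : Type*} [TopologicalSpace M] [ChartedSpace H' M] [IsManifold J ∞ M]

variable (I J) in
/-- The vector field `dι V` along `ι`, where `V` is the standard local extension of `v ∈ T_p M`. -/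
def dExtend (ι : M → N) {p : M} (v : TangentSpace J p) (x : M) : TangentSpace I (ι x) :=
  mfderiv J I ι x (FiberBundle.extend E' v x)

@[simp]
theorem dExtend_self (ι : M → N) {p : M} (v : TangentSpace J p) :
    dExtend I J ι v p = mfderiv J I ι p v := by
  simp [dExtend]

theorem diffAlongAt_dExtend {ι : M → N} (hι : ContMDiff J I ∞ ι) {p : M}
    (v : TangentSpace J p) : DiffAlongAt J ι (dExtend I J ι v) p := by
  have h1 : ContMDiff J.tangent I.tangent 1 (tangentMap J I ι) :=
    hι.contMDiff_tangentMap (m := 1) (by norm_cast)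
  exact (h1.mdifferentiableAt (by simp)).comp p (smoothFieldAt_extend v).diffFieldAt

/-- In charts `V` is a constant field, so `dι V` is a directional derivative of the coordinate
expression of `ι`. Differentiating once more then produces a genuine second derivative. -/
theorem alongCoord_dExtend {ι : M → N} (hι : ContMDiff J I ∞ ι) {p : M}
    (v : TangentSpace J p) :
    alongCoord ι (dExtend I J ι v) p =ᶠ[nhds p]
      (fun y => fderiv ℝ (writtenInExtChartAt J I p ι) y v) ∘ extChartAt J p := by
  have : IsManifold I 1 N := IsManifold.of_le (n := ∞) (by simp)
  have : IsManifold J 1 M := IsManifold.of_le (n := ∞) (by simp)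
  have hιd : MDifferentiable J I ι := hι.mdifferentiable (by simp)
  filter_upwards [eventually_mem_baseSet (hιd p), chart_source_mem_nhds H' p] with x hx hxp
  have hx' : ι x ∈ (chartAt H (ι p)).source := by
    rwa [TangentBundle.trivializationAt_baseSet] at hx
  have h2 := TangentBundle.continuousLinearMapAt_trivializationAt (I := I) hx'
  have h1 : alongCoord ι (dExtend I J ι v) p x =
      (trivializationAt E (fun x : N => TangentSpace I x) (ι p)).continuousLinearMapAt ℝ (ι x)
        (dExtend I J ι v x) := by
    rw [Trivialization.continuousLinearMapAt_apply,
      Trivialization.coe_linearMapAt_of_mem _ hx]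
    rfl
  have hsymm : (extChartAt J p).symm (extChartAt J p x) = x :=
    (extChartAt J p).left_inv (by simpa using hxp)
  have ht : extChartAt J p x ∈ (extChartAt J p).target :=
    (extChartAt J p).map_source (by simpa using hxp)
  have d1 : MDifferentiableAt 𝓘(ℝ, E') J (extChartAt J p).symm (extChartAt J p x) := by
    have := mdifferentiableWithinAt_extChartAt_symm (I := J) ht
    rwa [J.range_eq_univ, mdifferentiableWithinAt_univ] at this
  have d2 : MDifferentiableAt J I ι ((extChartAt J p).symm (extChartAt J p x)) := hιd _
  have d3 : MDifferentiableAt I 𝓘(ℝ, E) (extChartAt I (ι p))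
      (ι ((extChartAt J p).symm (extChartAt J p x))) := by
    rw [hsymm]; exact mdifferentiableAt_extChartAt hx'
  have h4 : mfderiv 𝓘(ℝ, E') 𝓘(ℝ, E) (writtenInExtChartAt J I p ι) (extChartAt J p x) =
      (mfderiv I 𝓘(ℝ, E) (extChartAt I (ι p)) (ι ((extChartAt J p).symm (extChartAt J p x)))).comp
      ((mfderiv J I ι ((extChartAt J p).symm (extChartAt J p x))).comp
        (mfderiv 𝓘(ℝ, E') J (extChartAt J p).symm (extChartAt J p x))) := by
    have e1 := mfderiv_comp (extChartAt J p x) d3 (d2.comp _ d1)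
    have e2 := mfderiv_comp (extChartAt J p x) d2 d1
    rw [← e2]
    exact e1
  rw [h1, h2, Function.comp_apply, ← mfderiv_eq_fderiv, h4]
  unfold dExtend
  rw [extend_eq_mfderivWithin v hxp, J.range_eq_univ, mfderivWithin_univ]
  -- The base points `z` and `x` are equal only by a proved identity, so the tangent vectors are
  -- compared after substitution.
  have aux : ∀ z, z = x → ∀ w : E', (mfderiv I 𝓘(ℝ, E) (extChartAt I (ι p)) (ι x)
      (mfderiv J I ι x w) : E) = mfderiv I 𝓘(ℝ, E) (extChartAt I (ι p)) (ι z)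
      (mfderiv J I ι z w) := by
    rintro _ rfl _
    rfl
  exact aux _ hsymm _

variable {nabla : CovariantDerivative I E (fun x : N => TangentSpace I x)}
  [RiemannianBundle (fun x : N => TangentSpace I x)]
  [IsContMDiffRiemannianBundle I ∞ E (fun x : N => TangentSpace I x)]

/-- The coordinate term is the second derivative of `ι` in charts, symmetric by smoothness; the
remaining term is symmetric by `nabla_extend_comm`. This is the source of the symmetry of `h`. -/
theorem covDerivAlong_dExtend_comm (hnabla : IsLeviCivita nabla) {ι : M → N}
    (hι : ContMDiff J I ∞ ι) {p : M} (u v : TangentSpace J p) :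
    covDerivAlong J nabla ι (dExtend I J ι v) p u =
      covDerivAlong J nabla ι (dExtend I J ι u) p v := by
  have : IsManifold J 1 M := IsManifold.of_le (n := ∞) (by simp)
  have hsm : ContDiffAt ℝ ∞ (writtenInExtChartAt J I p ι) (extChartAt J p p) := by
    have := (contMDiffAt_iff.1 (hι p)).2
    rwa [J.range_eq_univ, contDiffWithinAt_univ] at this
  have hsymm : IsSymmSndFDerivAt ℝ (writtenInExtChartAt J I p ι) (extChartAt J p p) :=
    hsm.isSymmSndFDerivAt (by rw [minSmoothness_of_isRCLikeNormedField]; norm_cast)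
  have hd : DifferentiableAt ℝ (fderiv ℝ (writtenInExtChartAt J I p ι)) (extChartAt J p p) :=
    (hsm.fderiv_right (m := 1) (by norm_cast)).differentiableAt (by simp)
  have key : ∀ a b : TangentSpace J p, mvfderiv J (alongCoord ι (dExtend I J ι a) p) p b =
      fderiv ℝ (fderiv ℝ (writtenInExtChartAt J I p ι)) (extChartAt J p p) b a := by
    intro a b
    have hg : ∀ a : E', HasFDerivAt (fun y => fderiv ℝ (writtenInExtChartAt J I p ι) y a)
        ((fderiv ℝ (fderiv ℝ (writtenInExtChartAt J I p ι)) (extChartAt J p p)).flip a)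
        (extChartAt J p p) := by
      intro a
      have h := hd.hasFDerivAt.clm_apply (hasFDerivAt_const a _)
      rwa [ContinuousLinearMap.comp_zero, zero_add] at h
    have hchart := mdifferentiableAt_extChartAt (I := J) (mem_chart_source H' p)
    rw [mvfderiv_congr_of_eventuallyEq (alongCoord_dExtend hι a)]
    have h5 := mfderiv_comp p (hg a).differentiableAt.mdifferentiableAt hchart
    rw [mfderiv_extChartAt_self, mfderiv_eq_fderiv, (hg a).fderiv] at h5
    simp only [mvfderiv]
    exact congrArg (fun L : E' →L[ℝ] E => L b) h5
  rw [covDerivAlong_eq, covDerivAlong_eq, key, key, hsymm u v, dExtend_self, dExtend_self,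
    nabla_extend_comm hnabla]

end Symmetry

/-! ### The pointwise algebra of cosymplectic structures. -/

section Algebra

open scoped InnerProductSpace

/-- The algebra behind "cosymplectic manifolds satisfy `∇φ = 0`": `P X Y` plays the role of
`(∇_X φ) Y` and `S X` that of `∇_X ξ`. -/
theorem eq_zero_of_cosymplectic_algebra {V : Type*} [NormedAddCommGroup V] [InnerProductSpace ℝ V]
    (φ : V →ₗ[ℝ] V) (ξ : V) (P : V → V → V) (S : V →ₗ[ℝ] V)
    (hφφ : ∀ u, φ (φ u) = -u + ⟪u, ξ⟫_ℝ • ξ) (hφξ : φ ξ = 0)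
    (hφ : ∀ u v, ⟪φ u, v⟫_ℝ = -⟪u, φ v⟫_ℝ)
    (hS : ∀ u v, ⟪S u, v⟫_ℝ = ⟪u, S v⟫_ℝ) (hSξ : ∀ u, ⟪S u, ξ⟫_ℝ = 0)
    (hPlin : ∀ u a b (r : ℝ), P u (-a + r • b) = -P u a + r • P u b) (hP0 : ∀ v, P 0 v = 0)
    (hPskew : ∀ u a b, ⟪P u a, b⟫_ℝ = -⟪a, P u b⟫_ℝ)
    (hcyc : ∀ X Y Z, ⟪Y, P X Z⟫_ℝ - ⟪X, P Y Z⟫_ℝ + ⟪X, P Z Y⟫_ℝ = 0)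
    (hN : ∀ X Y, P (φ X) Y - P (φ Y) X + φ (P Y X) - φ (P X Y) = 0)
    (hd : ∀ X Y, φ (P X Y) + P X (φ Y) = ⟪Y, S X⟫_ℝ • ξ + ⟪Y, ξ⟫_ℝ • S X)
    (hξ : ⟪ξ, ξ⟫_ℝ = 1) (X Y : V) : P X Y = 0 := by
  have hSξ0 : S ξ = 0 := ext_inner_right ℝ fun v => by
    rw [hS, real_inner_comm, hSξ, inner_zero_left]
  have hPlin0 : ∀ u, P u 0 = 0 := fun u => by
    have h := hPlin u 0 0 1
    simpa using h
  have hPξξ : ∀ u, ⟪P u ξ, ξ⟫_ℝ = 0 := fun u => by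
    have h := hPskew u ξ ξ
    rw [real_inner_comm] at h
    rw [real_inner_comm]
    linarith
  have hPξ : ∀ u, P u ξ = -φ (S u) := fun u => by
    have h := hd u ξ
    rw [hφξ, hPlin0, real_inner_comm, hSξ, hξ] at h
    have h2 := congrArg φ h
    simp only [add_zero, zero_smul, zero_add, one_smul, hφφ, hPξξ] at h2
    rw [← h2, neg_neg]
  -- The cyclic identity `hcyc` with one entry `ξ` determines `P ξ` from the values `P u ξ`.
  have hPξ' : ∀ u, P ξ u = -φ (S u) - S (φ u) := fun u => ext_inner_right ℝ fun v => by
    have h := hcyc ξ v u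
    have h1 := hPskew v ξ u
    have h2 := hPskew u ξ v
    rw [hPξ, inner_neg_left, hφ, hS] at h1
    rw [hPξ, inner_neg_left] at h2
    rw [inner_sub_left, inner_neg_left, real_inner_comm, real_inner_comm v (S (φ u))]
    linarith
  -- Normality at the pair `(u, ξ)` collapses to `-2 φ S φ u = 0`. As `S φ u` is orthogonal to `ξ`,
  -- where `φ` is injective, it vanishes.
  have hSφ : ∀ u, S (φ u) = 0 := fun u => by
    have h := hN u ξ
    rw [hφξ, hP0, hPξ, hPξ', hPξ] at h
    have h1 : φ (S (φ u)) = 0 := by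
      have h3 : (2 : ℝ) • φ (S (φ u)) = 0 := by
        rw [← neg_eq_zero, ← h]
        simp only [map_sub, map_neg]
        module
      simpa using h3
    have h2 := hφφ (S (φ u))
    rw [h1, hSξ, map_zero, zero_smul, add_zero] at h2
    exact neg_eq_zero.1 h2.symm
  have hS0 : ∀ u, S u = 0 := fun u => by
    have h := hSφ (φ u)
    rw [hφφ, map_add, map_smul, hSξ0, smul_zero, add_zero, map_neg] at h
    exact neg_eq_zero.1 h
  have hφP : ∀ u v, φ (P u v) = -P u (φ v) := fun u v => by
    have h := hd u v
    rw [hS0, inner_zero_right, zero_smul, smul_zero, add_zero] at h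
    exact eq_neg_of_add_eq_zero_left h
  -- With `S = 0` the trilinear expression `p` is skew in its last two slots, has zero cyclic sum,
  -- and lets `φ` move between the last two slots.
  let p : V → V → V → ℝ := fun a b c => ⟪P a b, c⟫_ℝ
  have pskew : ∀ a b c, p a b c = -p a c b := fun a b c => by
    simp only [p]; rw [hPskew, real_inner_comm]
  have pφ : ∀ a b c, p a (φ b) c = p a b (φ c) := fun a b c => by
    simp only [p]
    rw [← neg_eq_iff_eq_neg.2 (hφP a b), inner_neg_left, hφ, neg_neg]
  have pcyc : ∀ a b c, p a b c + p b c a + p c a b = 0 := fun a b c => by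
    have h := hcyc a b c
    have e1 : ⟪b, P a c⟫_ℝ = -p a b c := by simp only [p]; rw [hPskew, neg_neg]
    have e2 : ⟪a, P b c⟫_ℝ = p b c a := real_inner_comm _ _
    have e3 : ⟪a, P c b⟫_ℝ = -p c a b := by simp only [p]; rw [hPskew, neg_neg]
    rw [e1, e2, e3] at h
    linarith
  have pN : ∀ a b c, p (φ a) b c - p (φ b) a c - p b a (φ c) + p a b (φ c) = 0 := fun a b c => by
    have h := congrArg (fun w => ⟪w, c⟫_ℝ) (hN a b)
    simp only [inner_sub_left, inner_add_left, inner_zero_left, hφ] at h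
    simp only [p]
    linarith
  have hQ : ∀ a b c, p (φ a) b c + p a b (φ c) = 0 := by
    -- `Q` is symmetric in its first two slots by normality and skew in its last two, which forces
    -- `Q = 0`.
    let Q : V → V → V → ℝ := fun a b c => p (φ a) b c + p a b (φ c)
    have Qs : ∀ a b c, Q a b c = Q b a c := fun a b c => by
      have := pN a b c
      simp only [Q]; linarith
    have Qk : ∀ a b c, Q a b c = -Q a c b := fun a b c => by
      simp only [Q]
      rw [pskew (φ a) b c, pskew a b (φ c), pφ]; ring
    intro a b c
    change Q a b c = 0
    have h1 := Qs a b c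
    have h2 := Qk b a c
    have h3 := Qs b c a
    have h4 := Qk c b a
    have h5 := Qs c a b
    have h6 := Qk a c b
    linarith
  -- Adding the cyclic identities for `(φ c, a, b)` and `(c, a, φ b)`, the terms paired by `hQ`
  -- cancel and `2 p a (φ b) c` is left.
  have hfin : ∀ a b c, p a (φ b) c = 0 := fun a b c => by
    have h1 := pcyc (φ c) a b
    have h2 := pcyc c a (φ b)
    have h3 := hQ c a b
    have h4 := pφ a b c
    have h5 := pφ b c a
    have h6 := hQ b c a
    linarith
  -- Since `φ² Y = -Y + η(Y) ξ` and `P X ξ = -φ (S X) = 0`, vanishing on the image of `φ` is enough.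
  have h0 : P X (φ (φ Y)) = 0 := ext_inner_right ℝ fun v => by
    rw [inner_zero_left]; exact hfin X (φ Y) v
  rw [hφφ, hPlin, hPξ, hS0, map_zero, neg_zero, smul_zero, add_zero] at h0
  exact neg_eq_zero.1 h0

end Algebra

/-! ### Almost contact identities, and `∇φ = 0` on cosymplectic manifolds. -/

section Contact

variable {E : Type*} [NormedAddCommGroup E] [NormedSpace ℝ E] [FiniteDimensional ℝ E]
  {H : Type*} [TopologicalSpace H] {I : ModelWithCorners ℝ E H}
  {N : Type*} [TopologicalSpace N] [ChartedSpace H N] [IsManifold I ∞ N]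
  [RiemannianBundle (fun x : N => TangentSpace I x)]
  [IsContMDiffRiemannianBundle I ∞ E (fun x : N => TangentSpace I x)]

namespace AlmostContactMetric

variable (A : AlmostContactMetric I N)

theorem eta_eq_inner_of_phi_xi {x : N} (h : A.phi x (A.xi x) = 0) (u : TangentSpace I x) :
    A.eta x u = inner ℝ u (A.xi x) := by
  have := A.compatible x u (A.xi x)
  rw [h, inner_zero_right, A.eta_xi] at this
  linarith

theorem xi_ne_zero (x : N) : A.xi x ≠ 0 := fun h => by
  have := A.eta_xi x
  rw [h, map_zero] at this
  exact zero_ne_one this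

/-- `φ² ξ = 0`, so applying `φ²` to `φ ξ` also gives zero and shows `φ ξ = a ξ`. Then `φ² ξ = a² ξ`
forces `a = 0`. -/
theorem phi_xi (x : N) : A.phi x (A.xi x) = 0 := by
  have h1 : A.phi x (A.phi x (A.xi x)) = 0 := by
    rw [A.phi_phi, A.eta_xi, one_smul, neg_add_cancel]
  have h2 := A.phi_phi x (A.phi x (A.xi x))
  rw [h1, map_zero] at h2
  obtain ⟨a, h3⟩ : ∃ a : ℝ, A.phi x (A.xi x) = a • A.xi x := ⟨_, neg_add_eq_zero.1 h2.symm⟩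
  have h4 : a = 0 := by
    rw [h3, map_smul, h3, smul_smul, smul_eq_zero] at h1
    rcases h1 with h5 | h5
    · exact mul_self_eq_zero.1 h5
    · exact absurd h5 (A.xi_ne_zero x)
  rw [h3, h4, zero_smul]

theorem eta_eq_inner (x : N) (u : TangentSpace I x) : A.eta x u = inner ℝ u (A.xi x) :=
  A.eta_eq_inner_of_phi_xi (A.phi_xi x) u

/-- Compare `φ(φ² u)` with `φ²(φ u)`: they differ by `η(φ u) ξ`. -/
theorem eta_phi (x : N) (u : TangentSpace I x) : A.eta x (A.phi x u) = 0 := by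
  have h0 := congrArg (A.phi x) (A.phi_phi x u)
  rw [map_add, map_smul, A.phi_xi, smul_zero, add_zero, map_neg] at h0
  have h2 := left_eq_add.1 (h0.symm.trans (A.phi_phi x (A.phi x u)))
  exact (smul_eq_zero.1 h2).resolve_right (A.xi_ne_zero x)

theorem inner_phi_left (x : N) (u v : TangentSpace I x) :
    (inner ℝ (A.phi x u) v : ℝ) = -inner ℝ u (A.phi x v) := by
  have h := A.compatible x u (A.phi x v)
  rw [A.phi_phi, A.eta_phi, inner_add_right, inner_neg_right, inner_smul_right,
    ← A.eta_eq_inner, A.eta_phi] at h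
  linarith

theorem inner_xi_xi (x : N) : (inner ℝ (A.xi x) (A.xi x) : ℝ) = 1 := by
  rw [← A.eta_eq_inner, A.eta_xi]

end AlmostContactMetric

variable {A : AlmostContactMetric I N}
  {nabla : CovariantDerivative I E (fun x : N => TangentSpace I x)}

theorem AlmostContactMetric.IsKenmotsu.hasKenmotsuFactor (h : A.IsKenmotsu nabla) :
    HasKenmotsuFactor A nabla 1 := fun x u Y hY => by
  rw [one_smul]; exact h x u Y hY

variable (A nabla) in
-- The derivative terms of the two Leibniz rules cancel. By tensoriality, `∇φ` at a point can be
-- tested on coordinate fields, whose brackets vanish there.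
theorem tensorialAt_nabla_phi (x : N) : TensorialAt I E
    (fun Y : ∀ y : N, TangentSpace I y =>
      nabla (A.phiField Y) x - (A.phi x).comp (nabla Y x)) x where
  smul := by
    intro f Y hf hY
    have hY' : DiffFieldAt (A.phiField Y) x :=
      DiffAlongAt.phi A (ι := fun x : N => x) mdifferentiableAt_id hY
    have e : A.phiField (f • Y) = f • A.phiField Y := by
      funext y
      exact map_smul _ _ _
    have h1 := nabla.isCovariantDerivativeOnUniv.leibniz hY hf
    have h2 := nabla.isCovariantDerivativeOnUniv.leibniz hY' hf
    rw [e, h1, h2]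
    ext u
    simp only [_root_.sub_apply, _root_.add_apply, _root_.smul_apply,
      ContinuousLinearMap.comp_apply, ContinuousLinearMap.smulRight_apply, map_add, map_smul]
    have e2 : A.phiField Y x = A.phi x (Y x) := rfl
    rw [e2]
    module
  add := by
    intro Y Z hY hZ
    have hY' : DiffFieldAt (A.phiField Y) x :=
      DiffAlongAt.phi A (ι := fun x : N => x) mdifferentiableAt_id hY
    have hZ' : DiffFieldAt (A.phiField Z) x :=
      DiffAlongAt.phi A (ι := fun x : N => x) mdifferentiableAt_id hZ
    have e : A.phiField (Y + Z) = A.phiField Y + A.phiField Z := by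
      funext y
      exact map_add _ _ _
    have h1 := nabla.isCovariantDerivativeOnUniv.add hY hZ
    have h2 := nabla.isCovariantDerivativeOnUniv.add hY' hZ'
    rw [e, h1, h2]
    ext u
    simp only [_root_.sub_apply, _root_.add_apply, ContinuousLinearMap.comp_apply, map_add]
    abel

/-- On coordinate fields the closedness and normality conditions lose their bracket terms. They
become linear conditions on `∇φ` and `∇ξ` at one point, to which `eq_zero_of_cosymplectic_algebra`
applies. -/
theorem AlmostContactMetric.IsCosymplectic.hasKenmotsuFactor (hnabla : IsLeviCivita nabla)
    (h : A.IsCosymplectic) : HasKenmotsuFactor A nabla 0 := by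
  intro x u Y hY
  let X : TangentSpace I x → ∀ y : N, TangentSpace I y := fun a => FiberBundle.extend E a
  have hX : ∀ a, SmoothFieldAt (X a) x := fun a => smoothFieldAt_extend a
  have hXd : ∀ a, DiffFieldAt (X a) x := fun a => (hX a).diffFieldAt
  have hXx : ∀ a, X a x = a := fun a => FiberBundle.extend_apply_self E a
  have hφX : ∀ a, SmoothFieldAt (A.phiField (X a)) x := fun a => (hX a).phi A
  have hφXd : ∀ a, DiffFieldAt (A.phiField (X a)) x := fun a => (hφX a).diffFieldAt
  have hφXx : ∀ a, A.phiField (X a) x = A.phi x a := fun a => congrArg (A.phi x) (hXx a)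
  have hξd : DiffFieldAt A.xi x := (A.xi_smooth x).diffFieldAt
  have hbr : ∀ a b, VectorField.mlieBracket I (X a) (X b) x = 0 := fun a b =>
    mlieBracket_extend a b
  have hcomm : ∀ a b, nabla (X a) x b = nabla (X b) x a := fun a b => nabla_extend_comm hnabla a b
  let T := TensorialAt.mkHom _ x (tensorialAt_nabla_phi A nabla x)
  have hT : ∀ {Z : ∀ y : N, TangentSpace I y}, DiffFieldAt Z x → ∀ v,
      T (Z x) v = nabla (A.phiField Z) x v - A.phi x (nabla Z x v) := fun hZ v =>
    congrArg (fun L => L v) (TensorialAt.mkHom_apply (tensorialAt_nabla_phi A nabla x) hZ)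
  have hTX : ∀ a v, T a v = nabla (A.phiField (X a)) x v - A.phi x (nabla (X a) x v) :=
    fun a v => by
      have := hT (hXd a) v
      rwa [hXx] at this
  have hTX' : ∀ a v, nabla (A.phiField (X a)) x v = T a v + A.phi x (nabla (X a) x v) :=
    fun a v => by rw [hTX, sub_add_cancel]
  have hφ := A.inner_phi_left x
  have hdη : ∀ a b, A.dEta (X a) (X b) x = 0 := fun a b => h.eta_closed x _ _ (hX a) (hX b)
  have key : T (Y x) u = 0 := by
    refine eq_zero_of_cosymplectic_algebra (A.phi x).toLinearMap (A.xi x)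
      (fun v w => T w v) (nabla A.xi x).toLinearMap ?_ (A.phi_xi x) hφ ?_ ?_ ?_ ?_ ?_ ?_ ?_ ?_
      (A.inner_xi_xi x) u (Y x)
    · intro v
      rw [← A.eta_eq_inner]
      exact A.phi_phi x v
    -- `dη = 0` says that `∇ξ` is self-adjoint: the derivatives of the two coordinate fields cancel
    -- by `hcomm`.
    · intro a b
      have h1 := hdη a b
      simp only [AlmostContactMetric.dEta, hbr, A.eta_eq_inner, hXx, inner_zero_left] at h1
      rw [hnabla.metric _ _ _ _ (hXd b) hξd, hnabla.metric _ _ _ _ (hXd a) hξd, hXx, hXx,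
        hcomm] at h1
      have h2 := real_inner_comm (nabla A.xi x a) b
      change (inner ℝ (nabla A.xi x a) b : ℝ) = inner ℝ a (nabla A.xi x b)
      linarith
    · intro a
      have h1 := hnabla.metric x a _ _ hξd hξd
      simp only [A.inner_xi_xi, mvfderiv_const] at h1
      rw [real_inner_comm (nabla A.xi x a)] at h1
      change (inner ℝ (nabla A.xi x a) (A.xi x) : ℝ) = 0
      have h2 : (0 : TangentSpace I x →L[ℝ] ℝ) a = 0 := rfl
      rw [h2] at h1
      linarith
    · intro v a b r
      change T (-a + r • b) v = -T a v + r • T b v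
      rw [map_add, map_smul, map_neg]
      rfl
    · intro v
      exact map_zero _
    · intro v a b
      have h1 := hnabla.metric x v _ _ (hφXd a) (hXd b)
      have h2 := hnabla.metric x v _ _ (hXd a) (hφXd b)
      have h3 : mvfderiv I (fun y => (inner ℝ (A.phiField (X a) y) (X b y) : ℝ)) x v =
          -mvfderiv I (fun y => (inner ℝ (X a y) (A.phiField (X b) y) : ℝ)) x v := by
        have e : (fun y => (inner ℝ (A.phiField (X a) y) (X b y) : ℝ)) =
            fun y => -(inner ℝ (X a y) (A.phiField (X b) y) : ℝ) := by
          funext y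
          exact A.inner_phi_left y _ _
        rw [e, mvfderiv_fun_neg]
        rfl
      rw [h1, h2, hTX', hTX', hXx, hXx, hφXx, hφXx, inner_add_left, inner_add_right, hφ, hφ] at h3
      change (inner ℝ (T a v) b : ℝ) = -inner ℝ a (T b v)
      linarith
    -- In `dΦ = 0` the derivatives of the coordinate fields cancel in pairs, by `hcomm` and skewness
    -- of `φ`; only the `∇φ` terms survive.
    · intro a b c
      have h1 := h.fundForm_closed x _ _ _ (hX a) (hX b) (hX c)
      have e : ∀ a b c, mvfderiv I (A.fundForm (X a) (X b)) x c =
          inner ℝ (nabla (X a) x c) (A.phi x b) + inner ℝ a (T b c)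
          + inner ℝ a (A.phi x (nabla (X b) x c)) := fun a b c => by
        have h2 := hnabla.metric x c _ _ (hXd a) (hφXd b)
        rw [hTX', hφXx, hXx, inner_add_right, ← add_assoc] at h2
        exact h2
      have e0 : ∀ a b c, A.fundForm (VectorField.mlieBracket I (X a) (X b)) (X c) x = 0 :=
        fun a b c => by
          simp only [AlmostContactMetric.fundForm, hbr, inner_zero_left]
      simp only [AlmostContactMetric.dFundForm, e0, hXx, e] at h1
      change (inner ℝ b (T c a) : ℝ) - inner ℝ a (T c b) + inner ℝ a (T b c) = 0
      rw [hcomm b a, hcomm c a, hcomm c b] at h1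
      have h3 := hφ b (nabla (X a) x c)
      have h4 := real_inner_comm (nabla (X a) x c) (A.phi x b)
      linarith
    · intro a b
      have h1 := h.normal x _ _ (hX a) (hX b)
      rw [hdη, mul_zero, zero_smul, add_zero] at h1
      simp only [AlmostContactMetric.nijenhuis, hbr, map_zero, zero_add] at h1
      rw [hnabla.mlieBracket_eq (hφXd a) (hφXd b), hnabla.mlieBracket_eq (hφXd a) (hXd b),
        hnabla.mlieBracket_eq (hXd a) (hφXd b)] at h1
      simp only [hXx, hφXx, hTX', map_sub, map_add] at h1
      rw [hcomm a b] at h1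
      change T b (A.phi x a) - T a (A.phi x b) + A.phi x (T a b) - A.phi x (T b a) = 0
      rw [← h1]
      abel
    -- Differentiate `φ² = -I + η ⊗ ξ` along `a`.
    · intro a b
      have h1 := hT (hφXd b) a
      rw [hφXx] at h1
      have e : A.phiField (A.phiField (X b)) =
          ((-1 : ℝ) • X b) + ((fun y => (inner ℝ (X b y) (A.xi y) : ℝ)) • A.xi) := by
        funext y
        have := A.phi_phi y (X b y)
        rw [A.eta_eq_inner] at this
        simp only [Pi.add_apply, neg_smul, one_smul]
        exact this
      have hg := DiffFieldAt.inner (hXd b) hξd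
      have h2 := nabla.isCovariantDerivativeOnUniv.add (σ := (-1 : ℝ) • X b)
        (σ' := (fun y => (inner ℝ (X b y) (A.xi y) : ℝ)) • A.xi) (x := x)
        (mdifferentiableAt_const.smul_section (hXd b)) (hg.smul_section hξd)
      have h3 := nabla.isCovariantDerivativeOnUniv.smul_const (-1 : ℝ) (hXd b)
      have h4 := nabla.isCovariantDerivativeOnUniv.leibniz hξd hg
      rw [e, h2, h3, h4] at h1
      simp only [_root_.add_apply, _root_.smul_apply, ContinuousLinearMap.smulRight_apply] at h1
      rw [hnabla.metric _ _ _ _ (hXd b) hξd, hTX', map_add, A.phi_phi, A.eta_eq_inner, hXx] at h1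
      change A.phi x (T b a) + T (A.phi x b) a =
        (inner ℝ b (nabla A.xi x a) : ℝ) • A.xi x + (inner ℝ b (A.xi x) : ℝ) • nabla A.xi x a
      rw [h1]
      module
  rw [zero_smul, ← hT hY.diffFieldAt, key]

end Contact

/-! ### Coordinate fields on a product. -/

section ProductExtend

variable {E₁ : Type*} [NormedAddCommGroup E₁] [NormedSpace ℝ E₁] [FiniteDimensional ℝ E₁]
  {H₁ : Type*} [TopologicalSpace H₁] {I₁ : ModelWithCorners ℝ E₁ H₁} [I₁.Boundaryless]
  {B : Type*} [TopologicalSpace B] [ChartedSpace H₁ B] [IsManifold I₁ ∞ B]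
  {E₂ : Type*} [NormedAddCommGroup E₂] [NormedSpace ℝ E₂] [FiniteDimensional ℝ E₂]
  {H₂ : Type*} [TopologicalSpace H₂] {I₂ : ModelWithCorners ℝ E₂ H₂} [I₂.Boundaryless]
  {F : Type*} [TopologicalSpace F] [ChartedSpace H₂ F] [IsManifold I₂ ∞ F]

theorem extend_zero {p x : B} (hx : x ∈ (chartAt H₁ p).source) :
    FiberBundle.extend E₁ (0 : TangentSpace I₁ p) x = 0 := by
  rw [extend_eq_mfderivWithin 0 hx]
  exact map_zero _

/-- In the product chart `Prod.fst` is the linear projection, so it carries constant fields to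
constant fields. -/
theorem mfderiv_fst_extend {p : B × F} (v : TangentSpace (I₁.prod I₂) p) :
    ∀ᶠ x in nhds p, mfderiv (I₁.prod I₂) I₁ Prod.fst x (FiberBundle.extend (E₁ × E₂) v x) =
      FiberBundle.extend E₁
        (mfderiv (I₁.prod I₂) I₁ Prod.fst p v : TangentSpace I₁ p.1) x.1 := by
  have : IsManifold I₁ 1 B := IsManifold.of_le (n := ∞) (by simp)
  have : IsManifold (I₁.prod I₂) 1 (B × F) := IsManifold.of_le (n := ∞) (by simp)
  filter_upwards [chart_source_mem_nhds (ModelProd H₁ H₂) p] with x hx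
  have hx1 : x.1 ∈ (chartAt H₁ p.1).source := by
    rw [prodChartedSpace_chartAt] at hx
    exact hx.1
  rw [extend_eq_mfderivWithin v hx, extend_eq_mfderivWithin _ hx1, I₁.range_eq_univ,
    (I₁.prod I₂).range_eq_univ, mfderivWithin_univ, mfderivWithin_univ]
  have hsymm : (extChartAt (I₁.prod I₂) p).symm (extChartAt (I₁.prod I₂) p x) = x :=
    (extChartAt (I₁.prod I₂) p).left_inv (by simpa using hx)
  have ht : extChartAt (I₁.prod I₂) p x ∈ (extChartAt (I₁.prod I₂) p).target :=
    (extChartAt (I₁.prod I₂) p).map_source (by simpa using hx)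
  have ht1 : extChartAt I₁ p.1 x.1 ∈ (extChartAt I₁ p.1).target :=
    (extChartAt I₁ p.1).map_source (by simpa using hx1)
  have d1 : MDifferentiableAt 𝓘(ℝ, E₁ × E₂) (I₁.prod I₂) (extChartAt (I₁.prod I₂) p).symm
      (extChartAt (I₁.prod I₂) p x) := by
    have := mdifferentiableWithinAt_extChartAt_symm (I := I₁.prod I₂) ht
    rwa [(I₁.prod I₂).range_eq_univ, mdifferentiableWithinAt_univ] at this
  have d2 : MDifferentiableAt 𝓘(ℝ, E₁) I₁ (extChartAt I₁ p.1).symm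
      (extChartAt I₁ p.1 x.1) := by
    have := mdifferentiableWithinAt_extChartAt_symm (I := I₁) ht1
    rwa [I₁.range_eq_univ, mdifferentiableWithinAt_univ] at this
  have hfun : (Prod.fst : B × F → B) ∘ (extChartAt (I₁.prod I₂) p).symm =
      (extChartAt I₁ p.1).symm ∘ (Prod.fst : E₁ × E₂ → E₁) := by
    rw [extChartAt_prod]
    rfl
  have hbase : (extChartAt (I₁.prod I₂) p x).1 = extChartAt I₁ p.1 x.1 := by
    rw [extChartAt_prod]
    rfl
  have e1 := mfderiv_comp (extChartAt (I₁.prod I₂) p x)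
    (mdifferentiableAt_fst (I := I₁) (I' := I₂)
      (x := (extChartAt (I₁.prod I₂) p).symm (extChartAt (I₁.prod I₂) p x))) d1
  have e2 := mfderiv_comp_of_eq (I := 𝓘(ℝ, E₁ × E₂)) (I' := 𝓘(ℝ, E₁)) (I'' := I₁)
    (f := (Prod.fst : E₁ × E₂ → E₁)) (x := extChartAt (I₁.prod I₂) p x) d2
    differentiableAt_fst.mdifferentiableAt hbase
  rw [hfun, e2] at e1
  have h := congrArg (fun L : E₁ × E₂ →L[ℝ] E₁ => L v) e1
  have aux : ∀ z, z = x → ∀ w : E₁ × E₂, (mfderiv (I₁.prod I₂) I₁ Prod.fst x w : E₁) =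
      mfderiv (I₁.prod I₂) I₁ Prod.fst z w := by
    rintro _ rfl _
    rfl
  have aux' : ∀ z, z = extChartAt I₁ p.1 x.1 → ∀ w : E₁,
      (mfderiv 𝓘(ℝ, E₁) I₁ (extChartAt I₁ p.1).symm z w : E₁) =
        mfderiv 𝓘(ℝ, E₁) I₁ (extChartAt I₁ p.1).symm (extChartAt I₁ p.1 x.1) w := by
    rintro _ rfl _
    rfl
  have hfst : (mfderiv (I₁.prod I₂) I₁ Prod.fst p v : E₁) =
      mfderiv 𝓘(ℝ, E₁ × E₂) 𝓘(ℝ, E₁) Prod.fst (extChartAt (I₁.prod I₂) p x) v := by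
    rw [mfderiv_fst, mfderiv_eq_fderiv, fderiv_fst]
    rfl
  refine (aux _ hsymm _).trans (h.symm.trans ?_)
  exact (aux' _ hbase _).trans (congrArg _ hfst.symm)

theorem mfderiv_snd_extend {p : B × F} (v : TangentSpace (I₁.prod I₂) p) :
    ∀ᶠ x in nhds p, mfderiv (I₁.prod I₂) I₂ Prod.snd x (FiberBundle.extend (E₁ × E₂) v x) =
      FiberBundle.extend E₂
        (mfderiv (I₁.prod I₂) I₂ Prod.snd p v : TangentSpace I₂ p.2) x.2 := by
  have : IsManifold I₂ 1 F := IsManifold.of_le (n := ∞) (by simp)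
  have : IsManifold (I₁.prod I₂) 1 (B × F) := IsManifold.of_le (n := ∞) (by simp)
  filter_upwards [chart_source_mem_nhds (ModelProd H₁ H₂) p] with x hx
  have hx1 : x.2 ∈ (chartAt H₂ p.2).source := by
    rw [prodChartedSpace_chartAt] at hx
    exact hx.2
  rw [extend_eq_mfderivWithin v hx, extend_eq_mfderivWithin _ hx1, I₂.range_eq_univ,
    (I₁.prod I₂).range_eq_univ, mfderivWithin_univ, mfderivWithin_univ]
  have hsymm : (extChartAt (I₁.prod I₂) p).symm (extChartAt (I₁.prod I₂) p x) = x :=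
    (extChartAt (I₁.prod I₂) p).left_inv (by simpa using hx)
  have ht : extChartAt (I₁.prod I₂) p x ∈ (extChartAt (I₁.prod I₂) p).target :=
    (extChartAt (I₁.prod I₂) p).map_source (by simpa using hx)
  have ht1 : extChartAt I₂ p.2 x.2 ∈ (extChartAt I₂ p.2).target :=
    (extChartAt I₂ p.2).map_source (by simpa using hx1)
  have d1 : MDifferentiableAt 𝓘(ℝ, E₁ × E₂) (I₁.prod I₂) (extChartAt (I₁.prod I₂) p).symm
      (extChartAt (I₁.prod I₂) p x) := by
    have := mdifferentiableWithinAt_extChartAt_symm (I := I₁.prod I₂) ht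
    rwa [(I₁.prod I₂).range_eq_univ, mdifferentiableWithinAt_univ] at this
  have d2 : MDifferentiableAt 𝓘(ℝ, E₂) I₂ (extChartAt I₂ p.2).symm
      (extChartAt I₂ p.2 x.2) := by
    have := mdifferentiableWithinAt_extChartAt_symm (I := I₂) ht1
    rwa [I₂.range_eq_univ, mdifferentiableWithinAt_univ] at this
  have hfun : (Prod.snd : B × F → F) ∘ (extChartAt (I₁.prod I₂) p).symm =
      (extChartAt I₂ p.2).symm ∘ (Prod.snd : E₁ × E₂ → E₂) := by
    rw [extChartAt_prod]
    rfl
  have hbase : (extChartAt (I₁.prod I₂) p x).2 = extChartAt I₂ p.2 x.2 := by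
    rw [extChartAt_prod]
    rfl
  have e1 := mfderiv_comp (extChartAt (I₁.prod I₂) p x)
    (mdifferentiableAt_snd (I := I₁) (I' := I₂)
      (x := (extChartAt (I₁.prod I₂) p).symm (extChartAt (I₁.prod I₂) p x))) d1
  have e2 := mfderiv_comp_of_eq (I := 𝓘(ℝ, E₁ × E₂)) (I' := 𝓘(ℝ, E₂)) (I'' := I₂)
    (f := (Prod.snd : E₁ × E₂ → E₂)) (x := extChartAt (I₁.prod I₂) p x) d2
    differentiableAt_snd.mdifferentiableAt hbase
  rw [hfun, e2] at e1
  have h := congrArg (fun L : E₁ × E₂ →L[ℝ] E₂ => L v) e1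
  have aux : ∀ z, z = x → ∀ w : E₁ × E₂, (mfderiv (I₁.prod I₂) I₂ Prod.snd x w : E₂) =
      mfderiv (I₁.prod I₂) I₂ Prod.snd z w := by
    rintro _ rfl _
    rfl
  have aux' : ∀ z, z = extChartAt I₂ p.2 x.2 → ∀ w : E₂,
      (mfderiv 𝓘(ℝ, E₂) I₂ (extChartAt I₂ p.2).symm z w : E₂) =
        mfderiv 𝓘(ℝ, E₂) I₂ (extChartAt I₂ p.2).symm (extChartAt I₂ p.2 x.2) w := by
    rintro _ rfl _
    rfl
  have hsnd : (mfderiv (I₁.prod I₂) I₂ Prod.snd p v : E₂) =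
      mfderiv 𝓘(ℝ, E₁ × E₂) 𝓘(ℝ, E₂) Prod.snd (extChartAt (I₁.prod I₂) p x) v := by
    rw [mfderiv_snd, mfderiv_eq_fderiv, fderiv_snd]
    rfl
  refine (aux _ hsymm _).trans (h.symm.trans ?_)
  exact (aux' _ hbase _).trans (congrArg _ hsnd.symm)

end ProductExtend

/-! ### The tangential derivatives of a warped product. -/

section Warped

variable {E : Type*} [NormedAddCommGroup E] [NormedSpace ℝ E] [FiniteDimensional ℝ E]
  {H : Type*} [TopologicalSpace H] {I : ModelWithCorners ℝ E H}
  {N : Type*} [TopologicalSpace N] [ChartedSpace H N] [IsManifold I ∞ N]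
  [RiemannianBundle (fun x : N => TangentSpace I x)]
  [IsContMDiffRiemannianBundle I ∞ E (fun x : N => TangentSpace I x)]
  {nabla : CovariantDerivative I E (fun x : N => TangentSpace I x)}
  {E₁ : Type*} [NormedAddCommGroup E₁] [NormedSpace ℝ E₁] [FiniteDimensional ℝ E₁]
  {H₁ : Type*} [TopologicalSpace H₁] {I₁ : ModelWithCorners ℝ E₁ H₁} [I₁.Boundaryless]
  {B : Type*} [TopologicalSpace B] [ChartedSpace H₁ B] [IsManifold I₁ ∞ B]
  [RiemannianBundle (fun x : B => TangentSpace I₁ x)]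
  [IsContMDiffRiemannianBundle I₁ ∞ E₁ (fun x : B => TangentSpace I₁ x)]
  {E₂ : Type*} [NormedAddCommGroup E₂] [NormedSpace ℝ E₂] [FiniteDimensional ℝ E₂]
  {H₂ : Type*} [TopologicalSpace H₂] {I₂ : ModelWithCorners ℝ E₂ H₂} [I₂.Boundaryless]
  {F : Type*} [TopologicalSpace F] [ChartedSpace H₂ F] [IsManifold I₂ ∞ F]
  [RiemannianBundle (fun x : F => TangentSpace I₂ x)]
  [IsContMDiffRiemannianBundle I₂ ∞ E₂ (fun x : F => TangentSpace I₂ x)]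
  {f : B → ℝ} {ι : B × F → N} {p : B × F}

theorem mem_tangentBase {v : TangentSpace (I₁.prod I₂) p} :
    v ∈ tangentBase I₁ I₂ p ↔ mfderiv (I₁.prod I₂) I₂ Prod.snd p v = 0 := Iff.rfl

theorem mem_tangentFibre {v : TangentSpace (I₁.prod I₂) p} :
    v ∈ tangentFibre I₁ I₂ p ↔ mfderiv (I₁.prod I₂) I₁ Prod.fst p v = 0 := Iff.rfl

/-- The standard extension stays inside the distribution near `p`, so orthogonality relations can be
differentiated at `p`. -/
theorem extend_mem_tangentBase {v : TangentSpace (I₁.prod I₂) p}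
    (hv : v ∈ tangentBase I₁ I₂ p) :
    ∀ᶠ x in nhds p, FiberBundle.extend (E₁ × E₂) v x ∈ tangentBase I₁ I₂ x := by
  filter_upwards [mfderiv_snd_extend v,
    continuous_snd.continuousAt.eventually (chart_source_mem_nhds H₂ p.2)] with x hx hx2
  rw [mem_tangentBase, hx, mem_tangentBase.1 hv]
  exact extend_zero hx2

theorem extend_mem_tangentFibre {v : TangentSpace (I₁.prod I₂) p}
    (hv : v ∈ tangentFibre I₁ I₂ p) :
    ∀ᶠ x in nhds p, FiberBundle.extend (E₁ × E₂) v x ∈ tangentFibre I₁ I₂ x := by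
  filter_upwards [mfderiv_fst_extend v,
    continuous_fst.continuousAt.eventually (chart_source_mem_nhds H₁ p.1)] with x hx hx1
  rw [mem_tangentFibre, hx, mem_tangentFibre.1 hv]
  exact extend_zero hx1

variable (I I₁ I₂ ι) in
/-- `ι` is an isometry for the warped product metric. -/
def IsWarpedIsometry (f : B → ℝ) : Prop :=
  ∀ (p : B × F) (u v : TangentSpace (I₁.prod I₂) p),
    (inner ℝ (mfderiv (I₁.prod I₂) I ι p u) (mfderiv (I₁.prod I₂) I ι p v) : ℝ)
      = warpedMetric I₁ I₂ f p u v

variable (nabla ι) in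
/-- The tangential components `⟨∇_u (dι V), dι w⟩` of the ambient covariant derivative, where `V`
is the standard local extension of `v`. -/
def tangentialCov (u v w : TangentSpace (I₁.prod I₂) p) : ℝ :=
  inner ℝ (covDerivAlong (I₁.prod I₂) nabla ι (dExtend I (I₁.prod I₂) ι v) p u)
    (mfderiv (I₁.prod I₂) I ι p w)

theorem tangentialCov_comm (hnabla : IsLeviCivita nabla) (hι : ContMDiff (I₁.prod I₂) I ∞ ι)
    (u v w : TangentSpace (I₁.prod I₂) p) :
    tangentialCov nabla ι u v w = tangentialCov nabla ι v u w := by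
  rw [tangentialCov, covDerivAlong_dExtend_comm hnabla hι]
  rfl

theorem mvfderiv_inner_dExtend (hnabla : IsLeviCivita nabla) (hι : ContMDiff (I₁.prod I₂) I ∞ ι)
    (u v w : TangentSpace (I₁.prod I₂) p) :
    mvfderiv (I₁.prod I₂) (fun x => (inner ℝ (dExtend I (I₁.prod I₂) ι v x)
      (dExtend I (I₁.prod I₂) ι w x) : ℝ)) p u =
      tangentialCov nabla ι u v w + tangentialCov nabla ι u w v := by
  rw [covDerivAlong_inner hnabla ((hι p).mdifferentiableAt (by simp))
    (diffAlongAt_dExtend hι v) (diffAlongAt_dExtend hι w), dExtend_self, dExtend_self,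
    real_inner_comm _ (mfderiv (I₁.prod I₂) I ι p v)]
  rfl

theorem inner_dExtend (hisom : IsWarpedIsometry I I₁ I₂ ι f) (v w : TangentSpace (I₁.prod I₂) p) :
    ∀ᶠ x in nhds p, (inner ℝ (dExtend I (I₁.prod I₂) ι v x)
      (dExtend I (I₁.prod I₂) ι w x) : ℝ) =
      inner ℝ (FiberBundle.extend E₁ (mfderiv (I₁.prod I₂) I₁ Prod.fst p v : TangentSpace I₁ p.1)
        x.1) (FiberBundle.extend E₁
          (mfderiv (I₁.prod I₂) I₁ Prod.fst p w : TangentSpace I₁ p.1) x.1) +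
      f x.1 ^ 2 * inner ℝ (FiberBundle.extend E₂
        (mfderiv (I₁.prod I₂) I₂ Prod.snd p v : TangentSpace I₂ p.2) x.2)
        (FiberBundle.extend E₂
          (mfderiv (I₁.prod I₂) I₂ Prod.snd p w : TangentSpace I₂ p.2) x.2) := by
  filter_upwards [mfderiv_fst_extend v, mfderiv_fst_extend w, mfderiv_snd_extend v,
    mfderiv_snd_extend w] with x h1 h2 h3 h4
  rw [← h1, ← h2, ← h3, ← h4]
  exact hisom x _ _

theorem inner_base_fibre (hisom : IsWarpedIsometry I I₁ I₂ ι f)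
    {y z : TangentSpace (I₁.prod I₂) p} (hy : y ∈ tangentBase I₁ I₂ p)
    (hz : z ∈ tangentFibre I₁ I₂ p) :
    (inner ℝ (mfderiv (I₁.prod I₂) I ι p y) (mfderiv (I₁.prod I₂) I ι p z) : ℝ) = 0 := by
  rw [hisom, warpedMetric, mem_tangentBase.1 hy, mem_tangentFibre.1 hz, inner_zero_left,
    inner_zero_right, mul_zero, add_zero]

/-- Differentiate `⟨Y, Z⟩ = 0`, which holds on a neighbourhood of `p`. -/
theorem tangentialCov_base_fibre_skew (hnabla : IsLeviCivita nabla)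
    (hι : ContMDiff (I₁.prod I₂) I ∞ ι) (hisom : IsWarpedIsometry I I₁ I₂ ι f)
    {u y z : TangentSpace (I₁.prod I₂) p} (hy : y ∈ tangentBase I₁ I₂ p)
    (hz : z ∈ tangentFibre I₁ I₂ p) :
    tangentialCov nabla ι u y z + tangentialCov nabla ι u z y = 0 := by
  rw [← mvfderiv_inner_dExtend hnabla hι]
  have h : (fun x => (inner ℝ (dExtend I (I₁.prod I₂) ι y x)
      (dExtend I (I₁.prod I₂) ι z x) : ℝ)) =ᶠ[nhds p] fun _ => 0 := by
    filter_upwards [extend_mem_tangentBase hy, extend_mem_tangentFibre hz] with x h1 h2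
    exact inner_base_fibre hisom h1 h2
  rw [mvfderiv_congr_of_eventuallyEq h, mvfderiv_const]
  rfl

/-- `TB` is totally geodesic in `M`. This is Koszul's formula for commuting fields: the inner
product of two base fields depends only on the base point, so its derivative along the fibre
vanishes. -/
theorem tangentialCov_base_base_fibre (hnabla : IsLeviCivita nabla)
    (hι : ContMDiff (I₁.prod I₂) I ∞ ι) (hisom : IsWarpedIsometry I I₁ I₂ ι f)
    {x y z : TangentSpace (I₁.prod I₂) p} (hx : x ∈ tangentBase I₁ I₂ p)
    (hy : y ∈ tangentBase I₁ I₂ p) (hz : z ∈ tangentFibre I₁ I₂ p) :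
    tangentialCov nabla ι x y z = 0 := by
  have h1 := tangentialCov_base_fibre_skew (u := x) hnabla hι hisom hy hz
  have h2 := tangentialCov_base_fibre_skew (u := y) hnabla hι hisom hx hz
  have h3 := mvfderiv_inner_dExtend hnabla hι z x y
  rw [tangentialCov_comm hnabla hι z x, tangentialCov_comm hnabla hι z y] at h3
  rw [tangentialCov_comm hnabla hι y x] at h2
  have h4 : mvfderiv (I₁.prod I₂) (fun q => (inner ℝ (dExtend I (I₁.prod I₂) ι x q)
      (dExtend I (I₁.prod I₂) ι y q) : ℝ)) p z = 0 := by
    let k : B → ℝ := fun b => inner ℝ (FiberBundle.extend E₁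
      (mfderiv (I₁.prod I₂) I₁ Prod.fst p x : TangentSpace I₁ p.1) b) (FiberBundle.extend E₁
          (mfderiv (I₁.prod I₂) I₁ Prod.fst p y : TangentSpace I₁ p.1) b)
    have hk : MDifferentiableAt I₁ 𝓘(ℝ, ℝ) k p.1 :=
      DiffFieldAt.inner (smoothFieldAt_extend _).diffFieldAt (smoothFieldAt_extend _).diffFieldAt
    have h5 : (fun q => (inner ℝ (dExtend I (I₁.prod I₂) ι x q)
      (dExtend I (I₁.prod I₂) ι y q) : ℝ)) =ᶠ[nhds p] k ∘ Prod.fst := by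
      filter_upwards [inner_dExtend hisom x y,
        continuous_snd.continuousAt.eventually (chart_source_mem_nhds H₂ p.2)] with q hq hq2
      rw [hq, mem_tangentBase.1 hx, extend_zero hq2, inner_zero_left, mul_zero, add_zero]
      rfl
    rw [mvfderiv_congr_of_eventuallyEq h5, mvfderiv_comp p hk mdifferentiableAt_fst]
    rw [ContinuousLinearMap.comp_apply, mem_tangentFibre.1 hz, map_zero]
  linarith

/-- `X ↦ X(ln f)` on the warped product. -/
def dLog (I₁ : ModelWithCorners ℝ E₁ H₁) (I₂ : ModelWithCorners ℝ E₂ H₂) (f : B → ℝ) (p : B × F)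
    (x : TangentSpace (I₁.prod I₂) p) : ℝ :=
  mvfderiv I₁ (fun b => Real.log (f b)) p.1 (mfderiv (I₁.prod I₂) I₁ Prod.fst p x)

theorem mvfderiv_scalar_comp {g : ℝ → ℝ} {g' : ℝ} {b : B} (hg : HasDerivAt g g' (f b))
    (hf : MDifferentiableAt I₁ 𝓘(ℝ, ℝ) f b) (v : TangentSpace I₁ b) :
    mvfderiv I₁ (fun b => g (f b)) b v = g' * mvfderiv I₁ f b v := by
  have e := congrArg (fun L => L v) (mvfderiv_comp b hg.differentiableAt.mdifferentiableAt hf)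
  have h : ∀ w : ℝ, (mvfderiv 𝓘(ℝ, ℝ) g (f b) w : ℝ) = g' * w := fun w => by
    have h1 : (mvfderiv 𝓘(ℝ, ℝ) g (f b) w : ℝ) = fderiv ℝ g (f b) w := by
      rw [← mfderiv_eq_fderiv]
      rfl
    rw [h1, hg.hasFDerivAt.fderiv, ContinuousLinearMap.toSpanSingleton_apply, smul_eq_mul,
      mul_comm]
  exact e.trans (h _)

theorem mvfderiv_sq_eq_log (hf : ContMDiff I₁ 𝓘(ℝ, ℝ) ∞ f) (hf_pos : ∀ b, 0 < f b) (b : B)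
    (v : TangentSpace I₁ b) :
    mvfderiv I₁ (fun b => f b ^ 2) b v =
      2 * f b ^ 2 * mvfderiv I₁ (fun b => Real.log (f b)) b v := by
  have hfd : MDifferentiableAt I₁ 𝓘(ℝ, ℝ) f b := (hf b).mdifferentiableAt (by simp)
  have h2 : HasDerivAt (fun t : ℝ => t ^ 2) (2 * f b) (f b) := by
    simpa using hasDerivAt_pow 2 (f b)
  rw [mvfderiv_scalar_comp h2 hfd,
    mvfderiv_scalar_comp (Real.hasDerivAt_log (hf_pos b).ne') hfd]
  have := (hf_pos b).ne'
  field_simp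

/-- The warped product formula `∇_Z X = X(ln f) Z`, tested against the fibre. Near `p` the inner
product of two fibre fields is `f²` times a function on the fibre, so `X` differentiates only `f²`
and gives the factor `2 X(ln f)`. Koszul's formula halves it. -/
theorem tangentialCov_fibre_base_fibre (hnabla : IsLeviCivita nabla)
    (hι : ContMDiff (I₁.prod I₂) I ∞ ι) (hisom : IsWarpedIsometry I I₁ I₂ ι f)
    (hf : ContMDiff I₁ 𝓘(ℝ, ℝ) ∞ f) (hf_pos : ∀ b, 0 < f b)
    {x z w : TangentSpace (I₁.prod I₂) p} (hx : x ∈ tangentBase I₁ I₂ p)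
    (hz : z ∈ tangentFibre I₁ I₂ p) (hw : w ∈ tangentFibre I₁ I₂ p) :
    tangentialCov nabla ι z x w = dLog I₁ I₂ f p x *
      inner ℝ (mfderiv (I₁.prod I₂) I ι p z) (mfderiv (I₁.prod I₂) I ι p w) := by
  have h1 := tangentialCov_base_fibre_skew (u := z) hnabla hι hisom hx hw
  have h2 := tangentialCov_base_fibre_skew (u := w) hnabla hι hisom hx hz
  have h3 := mvfderiv_inner_dExtend hnabla hι x z w
  rw [tangentialCov_comm hnabla hι x z, tangentialCov_comm hnabla hι x w] at h3
  rw [tangentialCov_comm hnabla hι w z] at h2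
  have h4 : mvfderiv (I₁.prod I₂) (fun q => (inner ℝ (dExtend I (I₁.prod I₂) ι z q)
      (dExtend I (I₁.prod I₂) ι w q) : ℝ)) p x = 2 * dLog I₁ I₂ f p x *
      inner ℝ (mfderiv (I₁.prod I₂) I ι p z) (mfderiv (I₁.prod I₂) I ι p w) := by
    let k : F → ℝ := fun b => inner ℝ (FiberBundle.extend E₂
      (mfderiv (I₁.prod I₂) I₂ Prod.snd p z : TangentSpace I₂ p.2) b) (FiberBundle.extend E₂
          (mfderiv (I₁.prod I₂) I₂ Prod.snd p w : TangentSpace I₂ p.2) b)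
    have hk : MDifferentiableAt I₂ 𝓘(ℝ, ℝ) k p.2 :=
      DiffFieldAt.inner (smoothFieldAt_extend _).diffFieldAt (smoothFieldAt_extend _).diffFieldAt
    have hk' : MDifferentiableAt (I₁.prod I₂) 𝓘(ℝ, ℝ) (k ∘ Prod.snd) p :=
      hk.comp p mdifferentiableAt_snd
    have hfd : MDifferentiableAt I₁ 𝓘(ℝ, ℝ) (fun b => f b ^ 2) p.1 :=
      ((hf p.1).pow 2).mdifferentiableAt (by simp)
    have hfd' : MDifferentiableAt (I₁.prod I₂) 𝓘(ℝ, ℝ) ((fun b => f b ^ 2) ∘ Prod.fst) p :=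
      hfd.comp p mdifferentiableAt_fst
    have h5 : (fun q => (inner ℝ (dExtend I (I₁.prod I₂) ι z q)
      (dExtend I (I₁.prod I₂) ι w q) : ℝ)) =ᶠ[nhds p]
        ((fun b => f b ^ 2) ∘ Prod.fst) * (k ∘ Prod.snd) := by
      filter_upwards [inner_dExtend hisom z w,
        continuous_fst.continuousAt.eventually (chart_source_mem_nhds H₁ p.1)] with q hq hq2
      rw [hq, mem_tangentFibre.1 hz, extend_zero hq2, inner_zero_left, zero_add]
      rfl
    have h6 : (inner ℝ (mfderiv (I₁.prod I₂) I ι p z) (mfderiv (I₁.prod I₂) I ι p w) : ℝ) =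
        f p.1 ^ 2 * k p.2 := by
      have := h5.self_of_nhds
      simp only [dExtend_self] at this
      exact this
    rw [mvfderiv_congr_of_eventuallyEq h5, mvfderiv_mul hfd' hk',
      mvfderiv_comp p hk mdifferentiableAt_snd, mvfderiv_comp p hfd mdifferentiableAt_fst, h6]
    simp only [_root_.add_apply, _root_.smul_apply, ContinuousLinearMap.comp_apply, smul_eq_mul]
    rw [mem_tangentBase.1 hx, map_zero, mvfderiv_sq_eq_log hf hf_pos, dLog]
    simp only [Function.comp_apply]
    ring
  linarith

end Warped

/-! ### The second fundamental form and its component along `ξ`. -/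

section SecondFF

variable {E : Type*} [NormedAddCommGroup E] [NormedSpace ℝ E] [FiniteDimensional ℝ E]
  {H : Type*} [TopologicalSpace H] {I : ModelWithCorners ℝ E H}
  {N : Type*} [TopologicalSpace N] [ChartedSpace H N] [IsManifold I ∞ N]
  [RiemannianBundle (fun x : N => TangentSpace I x)]
  {nabla : CovariantDerivative I E (fun x : N => TangentSpace I x)}
  {E' : Type*} [NormedAddCommGroup E'] [NormedSpace ℝ E'] [FiniteDimensional ℝ E']
  {H' : Type*} [TopologicalSpace H'] {J : ModelWithCorners ℝ E' H'} [J.Boundaryless]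
  {M : Type*} [TopologicalSpace M] [ChartedSpace H' M] [IsManifold J ∞ M]
  {ι : M → N} {p : M}

theorem inner_normalPart (w : TangentSpace I (ι p)) {V : TangentSpace I (ι p)}
    (hV : V ∈ (tangentImage I J ι p)ᗮ) :
    (inner ℝ (normalPart J ι p w) V : ℝ) = inner ℝ w V := by
  rw [normalPart, Submodule.inner_starProjection_left_eq_right,
    Submodule.starProjection_eq_self_iff.2 hV]

theorem normalPart_mem (w : TangentSpace I (ι p)) :
    normalPart J ι p w ∈ (tangentImage I J ι p)ᗮ :=
  Submodule.starProjection_apply_mem _ _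

theorem secondFF_mem (u v : TangentSpace J p) :
    secondFF J nabla ι p u v ∈ (tangentImage I J ι p)ᗮ :=
  normalPart_mem _

theorem inner_secondFF (u v : TangentSpace J p) {V : TangentSpace I (ι p)}
    (hV : V ∈ (tangentImage I J ι p)ᗮ) :
    (inner ℝ (secondFF J nabla ι p u v) V : ℝ) =
      inner ℝ (covDerivAlong J nabla ι (dExtend I J ι v) p u) V :=
  inner_normalPart _ hV

theorem secondFF_add_left (u u' v : TangentSpace J p) :
    secondFF J nabla ι p (u + u') v = secondFF J nabla ι p u v + secondFF J nabla ι p u' v := by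
  simp only [secondFF, normalPart, covDerivAlong_add_vec, map_add]

theorem secondFF_smul_left (a : ℝ) (u v : TangentSpace J p) :
    secondFF J nabla ι p (a • u) v = a • secondFF J nabla ι p u v := by
  simp only [secondFF, normalPart, covDerivAlong_smul_vec, map_smul]

variable [IsContMDiffRiemannianBundle I ∞ E (fun x : N => TangentSpace I x)]

theorem secondFF_comm (hnabla : IsLeviCivita nabla) (hι : ContMDiff J I ∞ ι)
    (u v : TangentSpace J p) :
    secondFF J nabla ι p u v = secondFF J nabla ι p v u :=
  congrArg (normalPart J ι p) (covDerivAlong_dExtend_comm hnabla hι u v)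

variable (p) in
/-- The second fundamental form as a bilinear map. -/
def secondFFBilin (hnabla : IsLeviCivita nabla) (hι : ContMDiff J I ∞ ι) :
    TangentSpace J p →ₗ[ℝ] TangentSpace J p →ₗ[ℝ] TangentSpace I (ι p) :=
  LinearMap.mk₂ ℝ (secondFF J nabla ι p) secondFF_add_left secondFF_smul_left
    (fun u v w => by
      rw [secondFF_comm hnabla hι, secondFF_add_left, secondFF_comm hnabla hι v,
        secondFF_comm hnabla hι w])
    (fun a u v => by
      rw [secondFF_comm hnabla hι, secondFF_smul_left, secondFF_comm hnabla hι v])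

variable {A : AlmostContactMetric I N} {c : ℝ}

/-- The formula for `∇φ` applied to `ξ` gives `φ(∇_u ξ - c u) = 0`, so `∇_u ξ` equals `c u` up to a
multiple of `ξ`. -/
theorem HasKenmotsuFactor.inner_nabla_xi (hc : HasKenmotsuFactor A nabla c) {x : N}
    {v : TangentSpace I x} (hv : (inner ℝ v (A.xi x) : ℝ) = 0) (u : TangentSpace I x) :
    (inner ℝ v (nabla A.xi x u) : ℝ) = c * inner ℝ v u := by
  have h := hc x u A.xi (A.xi_smooth x)
  have h0 : A.phiField A.xi = 0 := funext fun y => A.phi_xi y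
  have h1 : nabla (A.phiField A.xi) x u = 0 := by
    rw [h0, nabla.zero]
    rfl
  rw [h1, ← A.eta_eq_inner, A.eta_phi, A.eta_xi, zero_smul, one_smul] at h
  have h2 : A.phi x (nabla A.xi x u - c • u) = 0 := by
    rw [zero_sub, zero_sub, smul_neg, neg_inj] at h
    rw [map_sub, map_smul, h, sub_self]
  have h3 := A.phi_phi x (nabla A.xi x u - c • u)
  rw [h2, map_zero] at h3
  have h4 := congrArg (fun w => (inner ℝ v w : ℝ)) h3
  simp only [inner_zero_right, inner_add_right, inner_neg_right, inner_sub_right,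
    inner_smul_right, hv, mul_zero, add_zero] at h4
  linarith

/-- Differentiate `⟨dι V, ξ⟩ = 0`. On the base block this yields the additive `2 m₁` of the Kenmotsu
case. -/
theorem inner_secondFF_xi (hnabla : IsLeviCivita nabla) (hι : ContMDiff J I ∞ ι)
    (hc : HasKenmotsuFactor A nabla c)
    (hξ : ∀ p, A.xi (ι p) ∈ (tangentImage I J ι p)ᗮ) (u v : TangentSpace J p) :
    (inner ℝ (secondFF J nabla ι p u v) (A.xi (ι p)) : ℝ) =
      -c * inner ℝ (mfderiv J I ι p u) (mfderiv J I ι p v) := by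
  have hιp : MDifferentiableAt J I ι p := (hι p).mdifferentiableAt (by simp)
  have hξd : DiffFieldAt A.xi (ι p) := (A.xi_smooth _).diffFieldAt
  have hperp : ∀ (x : M) (w : TangentSpace J x),
      (inner ℝ (mfderiv J I ι x w) (A.xi (ι x)) : ℝ) = 0 := fun x w =>
    (Submodule.mem_orthogonal _ _).1 (hξ x) _ ⟨w, rfl⟩
  have h := covDerivAlong_inner hnabla hιp (diffAlongAt_dExtend hι v)
    (DiffFieldAt.along hιp hξd) u
  have h0 : (fun x => (inner ℝ (dExtend I J ι v x) (A.xi (ι x)) : ℝ)) = fun _ => 0 :=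
    funext fun x => hperp x _
  rw [h0, mvfderiv_const, covDerivAlong_comp J nabla hιp hξd, dExtend_self,
    hc.inner_nabla_xi (hperp p v)] at h
  have h1 : (0 : TangentSpace J p →L[ℝ] ℝ) u = 0 := rfl
  rw [h1] at h
  rw [inner_secondFF _ _ (hξ p), real_inner_comm (mfderiv J I ι p v)]
  linarith

end SecondFF

/-! ### Components of `h` along `F D₂`. -/

section SemiSlantWarped

variable {E : Type*} [NormedAddCommGroup E] [NormedSpace ℝ E] [FiniteDimensional ℝ E]
  {H : Type*} [TopologicalSpace H] {I : ModelWithCorners ℝ E H}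
  {N : Type*} [TopologicalSpace N] [ChartedSpace H N] [IsManifold I ∞ N]
  [RiemannianBundle (fun x : N => TangentSpace I x)]
  [IsContMDiffRiemannianBundle I ∞ E (fun x : N => TangentSpace I x)]
  {nabla : CovariantDerivative I E (fun x : N => TangentSpace I x)}
  {E₁ : Type*} [NormedAddCommGroup E₁] [NormedSpace ℝ E₁] [FiniteDimensional ℝ E₁]
  {H₁ : Type*} [TopologicalSpace H₁] {I₁ : ModelWithCorners ℝ E₁ H₁} [I₁.Boundaryless]
  {B : Type*} [TopologicalSpace B] [ChartedSpace H₁ B] [IsManifold I₁ ∞ B]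
  [RiemannianBundle (fun x : B => TangentSpace I₁ x)]
  [IsContMDiffRiemannianBundle I₁ ∞ E₁ (fun x : B => TangentSpace I₁ x)]
  {E₂ : Type*} [NormedAddCommGroup E₂] [NormedSpace ℝ E₂] [FiniteDimensional ℝ E₂]
  {H₂ : Type*} [TopologicalSpace H₂] {I₂ : ModelWithCorners ℝ E₂ H₂} [I₂.Boundaryless]
  {F : Type*} [TopologicalSpace F] [ChartedSpace H₂ F] [IsManifold I₂ ∞ F]
  [RiemannianBundle (fun x : F => TangentSpace I₂ x)]
  [IsContMDiffRiemannianBundle I₂ ∞ E₂ (fun x : F => TangentSpace I₂ x)]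
  {f : B → ℝ} {ι : B × F → N} {p : B × F} {A : AlmostContactMetric I N} {c : ℝ} {θ : B × F → ℝ}

/-- The components of `h(u, Y)`, `Y` tangent to the base, along `φ Z - T` with `Z`, `T` tangent to
the fibre. -/
theorem inner_secondFF_base (hnabla : IsLeviCivita nabla)
    (hι : ContMDiff (I₁.prod I₂) I ∞ ι) (hisom : IsWarpedIsometry I I₁ I₂ ι f)
    (hc : HasKenmotsuFactor A nabla c)
    (hslant : IsPointwiseSemiSlant (I₁.prod I₂) A ι (tangentBase I₁ I₂) (tangentFibre I₁ I₂) θ)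
    (hξ : ∀ p, A.xi (ι p) ∈ (tangentImage I (I₁.prod I₂) ι p)ᗮ)
    {u y y' z t : TangentSpace (I₁.prod I₂) p} (hy : y ∈ tangentBase I₁ I₂ p)
    (hy' : y' ∈ tangentBase I₁ I₂ p) (hz : z ∈ tangentFibre I₁ I₂ p)
    (hyy' : A.phi (ι p) (mfderiv (I₁.prod I₂) I ι p y) = mfderiv (I₁.prod I₂) I ι p y')
    (hV : A.phi (ι p) (mfderiv (I₁.prod I₂) I ι p z) - mfderiv (I₁.prod I₂) I ι p t ∈
      (tangentImage I (I₁.prod I₂) ι p)ᗮ) :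
    (inner ℝ (secondFF (I₁.prod I₂) nabla ι p u y)
      (A.phi (ι p) (mfderiv (I₁.prod I₂) I ι p z) - mfderiv (I₁.prod I₂) I ι p t) : ℝ) =
      -tangentialCov nabla ι u y' z - tangentialCov nabla ι u y t := by
  have hιp : MDifferentiableAt (I₁.prod I₂) I ι p := (hι p).mdifferentiableAt (by simp)
  have hperp : ∀ w : TangentSpace (I₁.prod I₂) p,
      (inner ℝ (mfderiv (I₁.prod I₂) I ι p w) (A.xi (ι p)) : ℝ) = 0 := fun w =>
    (Submodule.mem_orthogonal _ _).1 (hξ p) _ ⟨w, rfl⟩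
  have hYd := diffAlongAt_dExtend (J := I₁.prod I₂) hι y
  have hZd := diffAlongAt_dExtend (J := I₁.prod I₂) hι z
  -- Near `p` the field `φ Y` stays in `TB`, hence orthogonal to `Z`. Differentiating `⟨φ Y, Z⟩ =
  -- 0`, the term from `∇φ` is a multiple of `ξ`, as `η(Y) = 0`, and is invisible to `Z`.
  have h1 := covDerivAlong_inner hnabla hιp (hYd.phi A hιp) hZd u
  have h2 : (fun x => (inner ℝ (A.phi (ι x) (dExtend I (I₁.prod I₂) ι y x))
      (dExtend I (I₁.prod I₂) ι z x) : ℝ)) =ᶠ[nhds p] fun _ => 0 := by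
    filter_upwards [extend_mem_tangentBase hy, extend_mem_tangentFibre hz] with x hx hx2
    obtain ⟨w, hw, hw'⟩ := hslant.phi_invariant x _ hx
    have h3 := inner_base_fibre hisom hw hx2
    rw [← hw'] at h3
    exact h3
  have h3 : (0 : TangentSpace (I₁.prod I₂) p →L[ℝ] ℝ) u = 0 := rfl
  rw [mvfderiv_congr_of_eventuallyEq h2, mvfderiv_const, h3, hc.covDerivAlong_phi hιp hYd,
    dExtend_self, dExtend_self, A.eta_eq_inner, hperp, zero_smul, sub_zero, hyy',
    inner_add_left, inner_smul_left, inner_smul_left, real_inner_comm _ (A.xi (ι p)), hperp,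
    A.inner_phi_left, real_inner_comm _ (mfderiv (I₁.prod I₂) I ι p y')] at h1
  have h4 := tangentialCov_base_fibre_skew (u := u) hnabla hι hisom hy' hz
  have h5 : tangentialCov nabla ι u z y' =
    inner ℝ (covDerivAlong (I₁.prod I₂) nabla ι (dExtend I (I₁.prod I₂) ι z) p u)
      (mfderiv (I₁.prod I₂) I ι p y') := rfl
  have h6 : tangentialCov nabla ι u y t =
    inner ℝ (covDerivAlong (I₁.prod I₂) nabla ι (dExtend I (I₁.prod I₂) ι y) p u)
      (mfderiv (I₁.prod I₂) I ι p t) := rfl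
  rw [inner_secondFF _ _ hV, inner_sub_right, ← h6]
  rw [← h5] at h1
  linarith

/-- For `Z` tangent to the fibre, the tangential part `T Z` of `φ Z` is tangent to the fibre. -/
theorem exists_phi_fibre (hisom : IsWarpedIsometry I I₁ I₂ ι f)
    (hslant : IsPointwiseSemiSlant (I₁.prod I₂) A ι (tangentBase I₁ I₂) (tangentFibre I₁ I₂) θ)
    {z : TangentSpace (I₁.prod I₂) p} (hz : z ∈ tangentFibre I₁ I₂ p) :
    ∃ t ∈ tangentFibre I₁ I₂ p, mfderiv (I₁.prod I₂) I ι p t =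
        ((tangentFibre I₁ I₂ p).map (mfderiv (I₁.prod I₂) I ι p).toLinearMap).starProjection
          (A.phi (ι p) (mfderiv (I₁.prod I₂) I ι p z)) ∧
      A.phi (ι p) (mfderiv (I₁.prod I₂) I ι p z) - mfderiv (I₁.prod I₂) I ι p t ∈
        (tangentImage I (I₁.prod I₂) ι p)ᗮ := by
  obtain ⟨t, ht, hts⟩ := Submodule.mem_map.1 (Submodule.starProjection_apply_mem
    ((tangentFibre I₁ I₂ p).map (mfderiv (I₁.prod I₂) I ι p).toLinearMap)
      (A.phi (ι p) (mfderiv (I₁.prod I₂) I ι p z)))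
  refine ⟨t, ht, hts, ?_⟩
  rw [Submodule.mem_orthogonal]
  rintro _ ⟨w, rfl⟩
  have hw : w ∈ tangentBase I₁ I₂ p ⊔ tangentFibre I₁ I₂ p := by
    rw [(hslant.isCompl p).sup_eq_top]
    trivial
  obtain ⟨x, hx, v, hv, rfl⟩ := Submodule.mem_sup.1 hw
  -- Against `TB`: `⟨x, φ z⟩ = -⟨φ x, z⟩` vanishes because `φ x` is again in `TB`.
  have h1 : (inner ℝ (mfderiv (I₁.prod I₂) I ι p x) (A.phi (ι p)
      (mfderiv (I₁.prod I₂) I ι p z) - mfderiv (I₁.prod I₂) I ι p t) : ℝ) = 0 := by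
    obtain ⟨x', hx', hxx'⟩ := hslant.phi_invariant p x hx
    have h2 := A.inner_phi_left (ι p) (mfderiv (I₁.prod I₂) I ι p x)
      (mfderiv (I₁.prod I₂) I ι p z)
    rw [hxx', inner_base_fibre hisom hx' hz] at h2
    rw [inner_sub_right, inner_base_fibre hisom hx ht]
    linarith
  have h2 : (inner ℝ (mfderiv (I₁.prod I₂) I ι p v) (A.phi (ι p)
      (mfderiv (I₁.prod I₂) I ι p z) - mfderiv (I₁.prod I₂) I ι p t) : ℝ) = 0 := by
    have h3 := Submodule.sub_starProjection_mem_orthogonal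
      (K := (tangentFibre I₁ I₂ p).map (mfderiv (I₁.prod I₂) I ι p).toLinearMap)
      (A.phi (ι p) (mfderiv (I₁.prod I₂) I ι p z))
    rw [← hts] at h3
    exact (Submodule.mem_orthogonal _ _).1 h3 _ ⟨v, hv, rfl⟩
  have h3 : (mfderiv (I₁.prod I₂) I ι p).toLinearMap (x + v) =
    mfderiv (I₁.prod I₂) I ι p x + mfderiv (I₁.prod I₂) I ι p v := map_add _ _ _
  rw [h3, inner_add_left, h1, h2, add_zero]

end SemiSlantWarped

/-! ### Norms of bilinear maps in orthonormal frames. -/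

section LinearAlgebra

open scoped InnerProductSpace

variable {V : Type*} [NormedAddCommGroup V] [InnerProductSpace ℝ V] [FiniteDimensional ℝ V]

/-- An orthonormal family of the right size, as an orthonormal basis. -/
def orthonormalBasisOfCard {α : Type*} [Fintype α] {v : α → V} (hv : Orthonormal ℝ v)
    (hcard : Fintype.card α = Module.finrank ℝ V) : OrthonormalBasis α ℝ V :=
  OrthonormalBasis.mk hv (by
    rw [hv.linearIndependent.span_eq_top_of_card_eq_finrank' hcard])

@[simp]
theorem orthonormalBasisOfCard_apply {α : Type*} [Fintype α] {v : α → V} (hv : Orthonormal ℝ v)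
    (hcard : Fintype.card α = Module.finrank ℝ V) (i : α) :
    orthonormalBasisOfCard hv hcard i = v i := by
  simp [orthonormalBasisOfCard]

theorem sum_sq_inner_of_orthonormal {α : Type*} [Fintype α] {v : α → V} (hv : Orthonormal ℝ v)
    (hcard : Fintype.card α = Module.finrank ℝ V) (w : V) :
    ∑ i, ⟪w, v i⟫_ℝ ^ 2 = ‖w‖ ^ 2 := by
  rw [← (orthonormalBasisOfCard hv hcard).sum_sq_norm_inner_left w]
  simp

/-- The sum is a trace, so it does not see the orthonormal basis. -/
theorem sum_sq_norm_linearMap_eq_trace {W : Type*} [NormedAddCommGroup W]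
    [InnerProductSpace ℝ W] [FiniteDimensional ℝ W] {α : Type*} [Fintype α]
    (b : OrthonormalBasis α ℝ W) (A : W →ₗ[ℝ] V) :
    ∑ i, ‖A (b i)‖ ^ 2 = LinearMap.trace ℝ W (A.adjoint ∘ₗ A) := by
  classical
  rw [LinearMap.trace_eq_sum_inner _ b]
  refine Finset.sum_congr rfl fun i _ => ?_
  rw [LinearMap.comp_apply, LinearMap.adjoint_inner_right, real_inner_self_eq_norm_sq]

variable {T : Type*} [AddCommGroup T] [Module ℝ T]

/-- `T` carries no inner product of its own here; orthonormality is read in `V` through `L`, so the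
trace is taken on the range of `L`. -/
theorem sum_sq_norm_eq_trace_of_orthonormal_comp {L : T →ₗ[ℝ] V} (hL : Function.Injective L)
    {α : Type*} [Fintype α] {e : α → T} (he : Orthonormal ℝ (L ∘ e))
    (hα : Fintype.card α = Module.finrank ℝ T) (A : T →ₗ[ℝ] V) :
    ∑ i, ‖A (e i)‖ ^ 2 = LinearMap.trace ℝ (LinearMap.range L)
      ((A ∘ₗ (LinearEquiv.ofInjective L hL).symm.toLinearMap).adjoint ∘ₗ
        (A ∘ₗ (LinearEquiv.ofInjective L hL).symm.toLinearMap)) := by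
  have h : Orthonormal ℝ (fun i => LinearEquiv.ofInjective L hL (e i)) := by
    have h1 : (LinearMap.range L).subtypeₗᵢ ∘ (fun i => LinearEquiv.ofInjective L hL (e i)) =
      L ∘ e := rfl
    rw [← h1] at he
    exact ((LinearMap.range L).subtypeₗᵢ.orthonormal_comp_iff).1 he
  have hr : Module.finrank ℝ (LinearMap.range L) = Module.finrank ℝ T :=
    LinearMap.finrank_range_of_inj hL
  rw [← sum_sq_norm_linearMap_eq_trace (orthonormalBasisOfCard h (hα.trans hr.symm))]
  simp

/-- For an injective linear map `L` into an inner product space, sums `∑ ‖A e_i‖²` over bases `e`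
with `L e` orthonormal do not depend on `e`. -/
theorem sum_sq_norm_eq_of_orthonormal_comp {L : T →ₗ[ℝ] V} (hL : Function.Injective L)
    {α β : Type*} [Fintype α] [Fintype β] {e : α → T} {e' : β → T}
    (he : Orthonormal ℝ (L ∘ e)) (he' : Orthonormal ℝ (L ∘ e'))
    (hα : Fintype.card α = Module.finrank ℝ T) (hβ : Fintype.card β = Module.finrank ℝ T)
    (A : T →ₗ[ℝ] V) : ∑ i, ‖A (e i)‖ ^ 2 = ∑ j, ‖A (e' j)‖ ^ 2 := by
  rw [sum_sq_norm_eq_trace_of_orthonormal_comp hL he hα,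
    sum_sq_norm_eq_trace_of_orthonormal_comp hL he' hβ]

theorem sum_sq_norm_bilin_eq {L : T →ₗ[ℝ] V} (hL : Function.Injective L)
    {α β : Type*} [Fintype α] [Fintype β] {e : α → T} {e' : β → T}
    (he : Orthonormal ℝ (L ∘ e)) (he' : Orthonormal ℝ (L ∘ e'))
    (hα : Fintype.card α = Module.finrank ℝ T) (hβ : Fintype.card β = Module.finrank ℝ T)
    (h : T →ₗ[ℝ] T →ₗ[ℝ] V) :
    ∑ i, ∑ j, ‖h (e i) (e j)‖ ^ 2 = ∑ i, ∑ j, ‖h (e' i) (e' j)‖ ^ 2 := by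
  calc ∑ i, ∑ j, ‖h (e i) (e j)‖ ^ 2 = ∑ i, ∑ j, ‖h (e i) (e' j)‖ ^ 2 :=
        Finset.sum_congr rfl fun i _ =>
          sum_sq_norm_eq_of_orthonormal_comp hL he he' hα hβ (h (e i))
    _ = ∑ j, ∑ i, ‖h (e i) (e' j)‖ ^ 2 := Finset.sum_comm
    _ = ∑ j, ∑ i, ‖h (e' i) (e' j)‖ ^ 2 := Finset.sum_congr rfl fun j _ =>
          sum_sq_norm_eq_of_orthonormal_comp hL he he' hα hβ (h.flip (e' j))
    _ = _ := Finset.sum_comm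

/-- A tangent frame `(x, z)`, a family `F` of orthogonal normal vectors of length `s` and a unit
normal vector `ξ` give an orthonormal family. -/
theorem orthonormal_frame {α β : Type*} [DecidableEq α] [DecidableEq β]
    {x : α → V} {z F : β → V} {ξ : V} {s : ℝ}
    (hs : 0 < s) (hxz : Orthonormal ℝ (Sum.elim x z))
    (hFF : ∀ a b, ⟪F a, F b⟫_ℝ = if a = b then s ^ 2 else 0)
    (hxF : ∀ i b, ⟪x i, F b⟫_ℝ = 0) (hzF : ∀ a b, ⟪z a, F b⟫_ℝ = 0)
    (hxξ : ∀ i, ⟪x i, ξ⟫_ℝ = 0) (hzξ : ∀ a, ⟪z a, ξ⟫_ℝ = 0) (hFξ : ∀ b, ⟪F b, ξ⟫_ℝ = 0)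
    (hξ : ⟪ξ, ξ⟫_ℝ = 1) :
    Orthonormal ℝ (Sum.elim (Sum.elim x z) (Sum.elim (fun b => s⁻¹ • F b) fun _ : Unit => ξ)) := by
  rw [orthonormal_iff_ite] at hxz ⊢
  have hxF' : ∀ i b, ⟪F b, x i⟫_ℝ = 0 := fun i b => by rw [real_inner_comm, hxF]
  have hzF' : ∀ a b, ⟪F b, z a⟫_ℝ = 0 := fun i b => by rw [real_inner_comm, hzF]
  have hxξ' : ∀ i, ⟪ξ, x i⟫_ℝ = 0 := fun i => by rw [real_inner_comm, hxξ]
  have hzξ' : ∀ a, ⟪ξ, z a⟫_ℝ = 0 := fun i => by rw [real_inner_comm, hzξ]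
  have hFξ' : ∀ b, ⟪ξ, F b⟫_ℝ = 0 := fun i => by rw [real_inner_comm, hFξ]
  rintro (i | i) (j | j)
  · simpa using hxz i j
  · rcases i with i | i <;> rcases j with j | j <;>
      simp [inner_smul_right, hxF, hzF, hxξ, hzξ]
  · rcases i with i | i <;> rcases j with j | j <;>
      simp [inner_smul_left, hxF', hzF', hxξ', hzξ']
  · rcases i with i | i <;> rcases j with j | j
    · rw [Sum.elim_inr, Sum.elim_inl, Sum.elim_inr, Sum.elim_inl, inner_smul_left,
        inner_smul_right, hFF]
      by_cases hij : i = j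
      · subst hij
        simp only [if_true, RCLike.conj_to_real]
        field_simp
      · simp [hij]
    · simp [inner_smul_left, hFξ]
    · simp [inner_smul_right, hFξ']
    · change ⟪ξ, ξ⟫_ℝ = _
      rw [hξ]
      simp

section Frame

variable {α β : Type*} [Fintype α] [Fintype β] [DecidableEq α] [DecidableEq β]
    {x : α → V} {z F : β → V} {ξ : V} {s : ℝ}

/-- Parseval: the dimension count turns the orthonormal family into a basis, leaving no normal
direction beyond the `F b` and `ξ`. -/
theorem norm_sq_eq_of_frame
    (hframe : Orthonormal ℝ
      (Sum.elim (Sum.elim x z) (Sum.elim (fun b => s⁻¹ • F b) fun _ : Unit => ξ)))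
    (hdim : Module.finrank ℝ V = Fintype.card α + 2 * Fintype.card β + 1) (w : V) :
    ‖w‖ ^ 2 = ∑ i, ⟪w, x i⟫_ℝ ^ 2 + ∑ a, ⟪w, z a⟫_ℝ ^ 2 +
      (s⁻¹ ^ 2 * ∑ b, ⟪w, F b⟫_ℝ ^ 2 + ⟪w, ξ⟫_ℝ ^ 2) := by
  rw [← sum_sq_inner_of_orthonormal hframe (by simp [hdim]; ring) w]
  simp [Fintype.sum_sum_type, inner_smul_right, mul_pow, Finset.mul_sum]

/-- The norm of a symmetric bilinear map `h` with prescribed components in an adapted frame. -/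
theorem sum_sq_norm_frame
    (hframe : Orthonormal ℝ
      (Sum.elim (Sum.elim x z) (Sum.elim (fun b => s⁻¹ • F b) fun _ : Unit => ξ)))
    (hdim : Module.finrank ℝ V = Fintype.card α + 2 * Fintype.card β + 1)
    (h : α ⊕ β → α ⊕ β → V) (hsymm : ∀ u v, h u v = h v u)
    (hx : ∀ u v i, ⟪h u v, x i⟫_ℝ = 0) (hz : ∀ u v a, ⟪h u v, z a⟫_ℝ = 0)
    {c k : ℝ} {l l' : α → ℝ} {τ : β → β → ℝ}
    (hxxF : ∀ i j b, ⟪h (Sum.inl i) (Sum.inl j), F b⟫_ℝ = 0)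
    (hxxξ : ∀ i j, ⟪h (Sum.inl i) (Sum.inl j), ξ⟫_ℝ = if i = j then -c else 0)
    (hzxF : ∀ a i b, ⟪h (Sum.inr a) (Sum.inl i), F b⟫_ℝ =
      -(if a = b then l' i else 0) - l i * τ a b)
    (hzxξ : ∀ a i, ⟪h (Sum.inr a) (Sum.inl i), ξ⟫_ℝ = 0)
    (hτ : ∀ a, τ a a = 0) (hτk : ∀ a, ∑ b, τ a b ^ 2 = k) :
    ∑ u, ∑ v, ‖h u v‖ ^ 2 = Fintype.card α * c ^ 2 +
      2 * (Fintype.card β * (s⁻¹ ^ 2 * (∑ i, l' i ^ 2 + k * ∑ i, l i ^ 2))) +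
      ∑ a, ∑ b, ‖h (Sum.inr a) (Sum.inr b)‖ ^ 2 := by
  have hn := norm_sq_eq_of_frame hframe hdim
  have h1 : ∀ i j, ‖h (Sum.inl i) (Sum.inl j)‖ ^ 2 = if i = j then c ^ 2 else 0 := fun i j => by
    rw [hn]
    simp only [hx, hz, hxxF, hxxξ]
    split_ifs <;> simp
  have h2 : ∀ a i, ‖h (Sum.inr a) (Sum.inl i)‖ ^ 2 = s⁻¹ ^ 2 * (l' i ^ 2 + k * l i ^ 2) :=
    fun a i => by
    rw [hn]
    simp only [hx, hz, hzxF, hzxξ]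
    have h3 : ∑ b, (-(if a = b then l' i else 0) - l i * τ a b) ^ 2 = l' i ^ 2 + k * l i ^ 2 := by
      -- The cross term lives only on `a = b`, where `τ a a = 0` kills it.
      have h4 : ∀ b, (-(if a = b then l' i else 0) - l i * τ a b) ^ 2 =
          (if a = b then l' i ^ 2 else 0) + l i ^ 2 * τ a b ^ 2 := fun b => by
        split_ifs with hab
        · subst hab
          rw [hτ]; ring
        · ring
      simp only [h4, Finset.sum_add_distrib, Finset.sum_ite_eq, Finset.mem_univ, if_true,
        ← Finset.mul_sum, hτk]
      ring
    rw [h3]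
    simp
  -- By symmetry each mixed pair is counted in both orders, whence the factor `2`.
  have h2' : ∀ a i, ‖h (Sum.inl i) (Sum.inr a)‖ ^ 2 = s⁻¹ ^ 2 * (l' i ^ 2 + k * l i ^ 2) :=
    fun a i => by rw [hsymm, h2]
  simp only [Fintype.sum_sum_type, h1, h2, h2', Finset.sum_add_distrib, Finset.sum_ite_eq,
    Finset.mem_univ, if_true, Finset.sum_const, Finset.card_univ, nsmul_eq_mul,
    ← Finset.mul_sum]
  ring

end Frame

end LinearAlgebra

/-! ### Consequences of the slant condition. -/

section Slant

open scoped InnerProductSpace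

/-- `⟪w, P w⟫ = |P w|²` for an orthogonal projection `P`, so the cosine of the angle is `|P w| /
|w|`. -/
theorem norm_starProjection_of_angle {V : Type*} [NormedAddCommGroup V] [InnerProductSpace ℝ V]
    [FiniteDimensional ℝ V] {K : Submodule ℝ V} {w : V} {θ : ℝ}
    (hθ : angleWithSubspace K w = θ) : ‖K.starProjection w‖ = Real.cos θ * ‖w‖ := by
  have h1 := InnerProductGeometry.cos_angle_mul_norm_mul_norm w (K.starProjection w)
  have h2 : ⟪w, K.starProjection w⟫_ℝ = ‖K.starProjection w‖ ^ 2 := by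
    have h3 := Submodule.inner_starProjection_left_eq_right K (K.starProjection w) w
    rw [Submodule.starProjection_eq_self_iff.2 (Submodule.starProjection_apply_mem K w)] at h3
    rw [real_inner_comm, h3, ← real_inner_self_eq_norm_sq]
  unfold angleWithSubspace at hθ
  rw [hθ, h2] at h1
  by_cases h0 : ‖K.starProjection w‖ = 0
  -- An angle with the zero vector is `π / 2` by convention, so both sides vanish.
  · rw [norm_eq_zero.1 h0, InnerProductGeometry.angle_zero_right] at hθ
    rw [h0, ← hθ, Real.cos_pi_div_two, zero_mul]
  · refine mul_right_cancel₀ h0 ?_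
    linarith

/-- If `φ` is isometric on `K` and the angle between `φ v` and `K` is `θ` for all nonzero
`v ∈ K`, the tangential part `T` of `φ` satisfies `⟪T v, T w⟫ = cos² θ ⟪v, w⟫` on `K`. -/
theorem inner_starProjection_of_slant {V : Type*} [NormedAddCommGroup V] [InnerProductSpace ℝ V]
    [FiniteDimensional ℝ V] {K : Submodule ℝ V} (φ : V →ₗ[ℝ] V) {θ : ℝ}
    (hφ : ∀ v ∈ K, ‖φ v‖ = ‖v‖)
    (hθ : ∀ v ∈ K, v ≠ 0 → angleWithSubspace K (φ v) = θ) {v w : V} (hv : v ∈ K) (hw : w ∈ K) :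
    ⟪K.starProjection (φ v), K.starProjection (φ w)⟫_ℝ = Real.cos θ ^ 2 * ⟪v, w⟫_ℝ := by
  have h : ∀ u ∈ K, ‖K.starProjection (φ u)‖ ^ 2 = Real.cos θ ^ 2 * ‖u‖ ^ 2 := fun u hu => by
    by_cases h0 : u = 0
    · simp [h0]
    · rw [norm_starProjection_of_angle (hθ u hu h0), hφ u hu, mul_pow]
  -- Polarization of the norm identity at `v + w`.
  have h1 := h _ (K.add_mem hv hw)
  rw [map_add, map_add, norm_add_sq_real, norm_add_sq_real, h v hv, h w hw] at h1
  linarith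

section Frame

variable {V : Type*} [NormedAddCommGroup V] [InnerProductSpace ℝ V] [FiniteDimensional ℝ V]
  {K : Submodule ℝ V} {φ : V →ₗ[ℝ] V} {θ : ℝ} {ξ : V}
  {α β : Type*} [Fintype α] [Fintype β] [DecidableEq α] [DecidableEq β] {x : α → V} {z : β → V}

/-- For `v, w` in `K`, `⟪F v, F w⟫ = ⟪φ v, φ w⟫ - ⟪T v, T w⟫ = (1 - cos² θ) ⟪v, w⟫`, which explains
the normalisation by `sin θ`. -/
theorem orthonormal_slant_frame (hxz : Orthonormal ℝ (Sum.elim x z))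
    (hxK : ∀ i, ∀ v ∈ K, ⟪x i, v⟫_ℝ = 0) (hzK : ∀ a, z a ∈ K)
    (hxφ : ∀ i, ∀ v ∈ K, ⟪x i, φ v⟫_ℝ = 0)
    (hxξ : ∀ i, ⟪x i, ξ⟫_ℝ = 0) (hKξ : ∀ v ∈ K, ⟪v, ξ⟫_ℝ = 0) (hξ : ⟪ξ, ξ⟫_ℝ = 1)
    (hφξ : ∀ v, ⟪φ v, ξ⟫_ℝ = 0) (hφ : ∀ v ∈ K, ∀ w ∈ K, ⟪φ v, φ w⟫_ℝ = ⟪v, w⟫_ℝ)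
    (hθ : ∀ v ∈ K, v ≠ 0 → angleWithSubspace K (φ v) = θ) (hs : 0 < Real.sin θ) :
    Orthonormal ℝ (Sum.elim (Sum.elim x z) (Sum.elim (fun b => (Real.sin θ)⁻¹ •
      (φ (z b) - K.starProjection (φ (z b)))) fun _ : Unit => ξ)) := by
  have hn : ∀ v ∈ K, ‖φ v‖ = ‖v‖ := fun v hv => by
    rw [norm_eq_sqrt_real_inner, hφ v hv v hv, ← norm_eq_sqrt_real_inner]
  have hP : ∀ v, K.starProjection v ∈ K := fun v => Submodule.starProjection_apply_mem K v
  have hperp : ∀ v ∈ K, ∀ w, ⟪v, w - K.starProjection w⟫_ℝ = 0 := fun v hv w =>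
    (Submodule.mem_orthogonal _ _).1 (Submodule.sub_starProjection_mem_orthogonal w) v hv
  refine orthonormal_frame hs hxz (fun a b => ?_) (fun i b => ?_)
    (fun a b => hperp _ (hzK a) _) hxξ (fun a => hKξ _ (hzK a)) (fun b => ?_) hξ
  · have h1 := inner_starProjection_of_slant φ hn hθ (hzK a) (hzK b)
    have h2 := hperp _ (hP (φ (z a))) (φ (z b))
    have h3 := hperp _ (hP (φ (z b))) (φ (z a))
    have h4 := orthonormal_iff_ite.1 hxz (Sum.inr a) (Sum.inr b)
    simp only [Sum.elim_inr, Sum.inr.injEq] at h4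
    rw [inner_sub_right] at h2 h3
    rw [real_inner_comm, real_inner_comm (K.starProjection (φ (z a)))] at h3
    rw [inner_sub_left, inner_sub_right, inner_sub_right, hφ _ (hzK a) _ (hzK b)]
    rw [h4] at h1 ⊢
    have h5 := Real.sin_sq_add_cos_sq θ
    split_ifs at h1 ⊢ <;> linarith
  · rw [inner_sub_right, hxφ i _ (hzK b), hxK i _ (hP _), sub_zero]
  · rw [inner_sub_left, hφξ, hKξ _ (hP _), sub_zero]

/-- A vector of `K` is orthogonal to every frame vector except the `z a`, so Parseval in the whole
space becomes Parseval in `K`, with no separate dimension count for `K`. -/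
theorem norm_sq_of_mem_slant {s : ℝ} (hframe : Orthonormal ℝ (Sum.elim (Sum.elim x z)
      (Sum.elim (fun b => s⁻¹ • (φ (z b) - K.starProjection (φ (z b)))) fun _ : Unit => ξ)))
    (hdim : Module.finrank ℝ V = Fintype.card α + 2 * Fintype.card β + 1)
    (hxK : ∀ i, ∀ v ∈ K, ⟪x i, v⟫_ℝ = 0) (hKξ : ∀ v ∈ K, ⟪v, ξ⟫_ℝ = 0) {v : V} (hv : v ∈ K) :
    ‖v‖ ^ 2 = ∑ a, ⟪v, z a⟫_ℝ ^ 2 := by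
  have hperp : ∀ w, ⟪v, w - K.starProjection w⟫_ℝ = 0 := fun w =>
    (Submodule.mem_orthogonal _ _).1 (Submodule.sub_starProjection_mem_orthogonal w) v hv
  have hx : ∀ i, ⟪v, x i⟫_ℝ = 0 := fun i => by rw [real_inner_comm, hxK i v hv]
  rw [norm_sq_eq_of_frame hframe hdim]
  simp [hperp, hx, hKξ v hv]

/-- Parseval applied to `v - ∑ ⟪v, z a⟫ z a`, whose coefficients all vanish. It shows that the `z a`
span the image of the fibre. -/
theorem eq_sum_of_norm_sq_eq (hz : Orthonormal ℝ z) (hzK : ∀ a, z a ∈ K)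
    (h : ∀ v ∈ K, ‖v‖ ^ 2 = ∑ a, ⟪v, z a⟫_ℝ ^ 2) {v : V} (hv : v ∈ K) :
    v = ∑ a, ⟪v, z a⟫_ℝ • z a := by
  rw [← sub_eq_zero, ← norm_eq_zero, ← sq_eq_zero_iff,
    h _ (K.sub_mem hv (K.sum_mem fun a _ => K.smul_mem _ (hzK a)))]
  refine Finset.sum_eq_zero fun a _ => ?_
  rw [inner_sub_left, hz.inner_left_fintype]
  simp

end Frame

end Slant

/-! ### Orthonormal frames of the warped product and the gradient. -/

section Main

variable {E : Type*} [NormedAddCommGroup E] [NormedSpace ℝ E] [FiniteDimensional ℝ E]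
  {H : Type*} [TopologicalSpace H] {I : ModelWithCorners ℝ E H}
  {N : Type*} [TopologicalSpace N] [ChartedSpace H N] [IsManifold I ∞ N]
  [RiemannianBundle (fun x : N => TangentSpace I x)]
  [IsContMDiffRiemannianBundle I ∞ E (fun x : N => TangentSpace I x)]
  {nabla : CovariantDerivative I E (fun x : N => TangentSpace I x)}
  {E₁ : Type*} [NormedAddCommGroup E₁] [NormedSpace ℝ E₁] [FiniteDimensional ℝ E₁]
  {H₁ : Type*} [TopologicalSpace H₁] {I₁ : ModelWithCorners ℝ E₁ H₁} [I₁.Boundaryless]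
  {B : Type*} [TopologicalSpace B] [ChartedSpace H₁ B] [IsManifold I₁ ∞ B]
  [RiemannianBundle (fun x : B => TangentSpace I₁ x)]
  [IsContMDiffRiemannianBundle I₁ ∞ E₁ (fun x : B => TangentSpace I₁ x)]
  {E₂ : Type*} [NormedAddCommGroup E₂] [NormedSpace ℝ E₂] [FiniteDimensional ℝ E₂]
  {H₂ : Type*} [TopologicalSpace H₂] {I₂ : ModelWithCorners ℝ E₂ H₂} [I₂.Boundaryless]
  {F : Type*} [TopologicalSpace F] [ChartedSpace H₂ F] [IsManifold I₂ ∞ F]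
  [RiemannianBundle (fun x : F => TangentSpace I₂ x)]
  [IsContMDiffRiemannianBundle I₂ ∞ E₂ (fun x : F => TangentSpace I₂ x)]
  {f : B → ℝ} {ι : B × F → N} {p : B × F} {A : AlmostContactMetric I N} {c : ℝ} {θ : B × F → ℝ}

theorem sum_sq_mvfderiv_eq_norm_grad (k : B → ℝ) (b : B) {α : Type*} [Fintype α]
    {v : α → TangentSpace I₁ b} (hv : Orthonormal ℝ v)
    (hcard : Fintype.card α = Module.finrank ℝ E₁) :
    ∑ i, mvfderiv I₁ k b (v i) ^ 2 = ‖grad I₁ k b‖ ^ 2 := by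
  have : CompleteSpace (TangentSpace I₁ b) := FiniteDimensional.complete ℝ _
  rw [← sum_sq_inner_of_orthonormal hv hcard (grad I₁ k b)]
  refine Finset.sum_congr rfl fun i _ => ?_
  rw [grad, InnerProductSpace.toDual_symm_apply]

theorem mfderiv_fst_mk (a : E₁) (b : E₂) :
    (mfderiv (I₁.prod I₂) I₁ (Prod.fst : B × F → B) p
      ((a, b) : E₁ × E₂) : E₁) = a := by
  rw [mfderiv_fst]
  rfl

theorem mfderiv_snd_mk (a : E₁) (b : E₂) :
    (mfderiv (I₁.prod I₂) I₂ (Prod.snd : B × F → F) p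
      ((a, b) : E₁ × E₂) : E₂) = b := by
  rw [mfderiv_snd]
  rfl

theorem IsWarpedIsometry.injective (hisom : IsWarpedIsometry I I₁ I₂ ι f)
    (hf_pos : ∀ b, 0 < f b) (p : B × F) :
    Function.Injective (mfderiv (I₁.prod I₂) I ι p).toLinearMap := by
  rw [← LinearMap.ker_eq_bot, LinearMap.ker_eq_bot']
  intro w hw
  have h1 := hisom p w w
  have hw' : mfderiv (I₁.prod I₂) I ι p w = 0 := hw
  rw [hw', inner_zero_left, warpedMetric] at h1
  have h2 : (0 : ℝ) ≤ inner ℝ (mfderiv (I₁.prod I₂) I₁ Prod.fst p w)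
    (mfderiv (I₁.prod I₂) I₁ Prod.fst p w) := real_inner_self_nonneg
  have h3 : (0 : ℝ) ≤ inner ℝ (mfderiv (I₁.prod I₂) I₂ Prod.snd p w)
    (mfderiv (I₁.prod I₂) I₂ Prod.snd p w) := real_inner_self_nonneg
  have h4 := pow_pos (hf_pos p.1) 2
  have h5 := mul_nonneg h4.le h3
  have h6 : mfderiv (I₁.prod I₂) I₁ Prod.fst p w = 0 :=
    (inner_self_eq_zero (𝕜 := ℝ)).1 (by linarith)
  have h7 : mfderiv (I₁.prod I₂) I₂ Prod.snd p w = 0 :=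
    (inner_self_eq_zero (𝕜 := ℝ)).1
      ((mul_eq_zero.1 (show f p.1 ^ 2 * _ = 0 by linarith)).resolve_left h4.ne')
  rw [mfderiv_fst] at h6
  rw [mfderiv_snd] at h7
  exact Prod.ext h6 h7

variable (I₁ I₂) in
/-- The warped product has an orthonormal frame adapted to the splitting `TB ⊕ TF`. -/
theorem exists_adapted_frame (hf_pos : ∀ b, 0 < f b) (p : B × F) :
    ∃ (x : Fin (Module.finrank ℝ E₁) → TangentSpace (I₁.prod I₂) p)
      (z : Fin (Module.finrank ℝ E₂) → TangentSpace (I₁.prod I₂) p),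
      (∀ i, x i ∈ tangentBase I₁ I₂ p) ∧ (∀ a, z a ∈ tangentFibre I₁ I₂ p) ∧
      ∀ u v, warpedMetric I₁ I₂ f p (Sum.elim x z u) (Sum.elim x z v) = if u = v then 1 else 0 := by
  let b₁ : OrthonormalBasis (Fin (Module.finrank ℝ E₁)) ℝ (TangentSpace I₁ p.1) :=
    stdOrthonormalBasis ℝ (TangentSpace I₁ p.1)
  let b₂ : OrthonormalBasis (Fin (Module.finrank ℝ E₂)) ℝ (TangentSpace I₂ p.2) :=
    stdOrthonormalBasis ℝ (TangentSpace I₂ p.2)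
  let x : Fin (Module.finrank ℝ E₁) → TangentSpace (I₁.prod I₂) p := fun i =>
    (show E₁ × E₂ from ((b₁ i : E₁), (0 : E₂)))
  -- The factor `f⁻¹` normalises for the metric `f² g_F` on the fibre.
  let z : Fin (Module.finrank ℝ E₂) → TangentSpace (I₁.prod I₂) p := fun a =>
    (show E₁ × E₂ from ((0 : E₁), (((f p.1)⁻¹ • b₂ a : TangentSpace I₂ p.2) : E₂)))
  have hx1 : ∀ i, mfderiv (I₁.prod I₂) I₁ Prod.fst p (x i) = b₁ i := fun i => mfderiv_fst_mk _ _
  have hx2 : ∀ i, mfderiv (I₁.prod I₂) I₂ Prod.snd p (x i) = 0 := fun i => mfderiv_snd_mk _ _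
  have hz1 : ∀ a, mfderiv (I₁.prod I₂) I₁ Prod.fst p (z a) = 0 := fun i => mfderiv_fst_mk _ _
  have hz2 : ∀ a, mfderiv (I₁.prod I₂) I₂ Prod.snd p (z a) = (f p.1)⁻¹ • b₂ a :=
    fun i => mfderiv_snd_mk _ _
  refine ⟨x, z, hx2, hz1, ?_⟩
  have hf := (hf_pos p.1).ne'
  rintro (i | i) (j | j)
  · simp only [warpedMetric, Sum.elim_inl, hx1, hx2, inner_zero_left, mul_zero, add_zero,
      orthonormal_iff_ite.1 b₁.orthonormal, Sum.inl.injEq]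
  · simp only [warpedMetric, Sum.elim_inl, Sum.elim_inr, hx1, hx2, hz1, hz2, inner_zero_left,
      inner_zero_right, mul_zero, add_zero]
    simp
  · simp only [warpedMetric, Sum.elim_inl, Sum.elim_inr, hx1, hx2, hz1, hz2, inner_zero_left,
      inner_zero_right, mul_zero, add_zero]
    simp
  · simp only [warpedMetric, Sum.elim_inr, hz1, hz2, inner_zero_left, zero_add,
      inner_smul_left, inner_smul_right, orthonormal_iff_ite.1 b₂.orthonormal, Sum.inr.injEq,
      RCLike.conj_to_real]
    split_ifs
    · field_simp
    · simp

end Main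

/-! ### The exact formula for the squared norm of `h`. -/

section Identity

variable {E : Type*} [NormedAddCommGroup E] [NormedSpace ℝ E] [FiniteDimensional ℝ E]
  {H : Type*} [TopologicalSpace H] {I : ModelWithCorners ℝ E H}
  {N : Type*} [TopologicalSpace N] [ChartedSpace H N] [IsManifold I ∞ N]
  [RiemannianBundle (fun x : N => TangentSpace I x)]
  [IsContMDiffRiemannianBundle I ∞ E (fun x : N => TangentSpace I x)]
  {nabla : CovariantDerivative I E (fun x : N => TangentSpace I x)}
  {E₁ : Type*} [NormedAddCommGroup E₁] [NormedSpace ℝ E₁] [FiniteDimensional ℝ E₁]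
  {H₁ : Type*} [TopologicalSpace H₁] {I₁ : ModelWithCorners ℝ E₁ H₁} [I₁.Boundaryless]
  {B : Type*} [TopologicalSpace B] [ChartedSpace H₁ B] [IsManifold I₁ ∞ B]
  [RiemannianBundle (fun x : B => TangentSpace I₁ x)]
  [IsContMDiffRiemannianBundle I₁ ∞ E₁ (fun x : B => TangentSpace I₁ x)]
  {E₂ : Type*} [NormedAddCommGroup E₂] [NormedSpace ℝ E₂] [FiniteDimensional ℝ E₂]
  {H₂ : Type*} [TopologicalSpace H₂] {I₂ : ModelWithCorners ℝ E₂ H₂} [I₂.Boundaryless]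
  {F : Type*} [TopologicalSpace F] [ChartedSpace H₂ F] [IsManifold I₂ ∞ F]
  [RiemannianBundle (fun x : F => TangentSpace I₂ x)]
  [IsContMDiffRiemannianBundle I₂ ∞ E₂ (fun x : F => TangentSpace I₂ x)]
  {f : B → ℝ} {ι : B × F → N} {p : B × F} {A : AlmostContactMetric I N} {c : ℝ} {θ : B × F → ℝ}

/-- An orthonormal frame of the base gives the norm of the gradient of `ln f`. -/
theorem sum_sq_dLog (hisom : IsWarpedIsometry I I₁ I₂ ι f) {α : Type*} [Fintype α] [DecidableEq α]
    (hcard : Fintype.card α = Module.finrank ℝ E₁)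
    {x : α → TangentSpace (I₁.prod I₂) p} (hx : ∀ i, x i ∈ tangentBase I₁ I₂ p)
    (hon : ∀ i j, (inner ℝ (mfderiv (I₁.prod I₂) I ι p (x i))
      (mfderiv (I₁.prod I₂) I ι p (x j)) : ℝ) = if i = j then 1 else 0) :
    ∑ i, dLog I₁ I₂ f p (x i) ^ 2 = ‖grad I₁ (fun b => Real.log (f b)) p.1‖ ^ 2 := by
  refine sum_sq_mvfderiv_eq_norm_grad (fun b => Real.log (f b)) p.1
    (v := fun i => mfderiv (I₁.prod I₂) I₁ Prod.fst p (x i)) ?_ hcard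
  rw [orthonormal_iff_ite]
  intro i j
  have h := hon i j
  rw [hisom, warpedMetric, mem_tangentBase.1 (hx i), inner_zero_left, mul_zero, add_zero] at h
  exact h

/-- The exact value of the squared norm of the second fundamental form of a pointwise semi-slant
warped product. -/
theorem exists_secondFFSqNorm_eq (hnabla : IsLeviCivita nabla)
    (hι : ContMDiff (I₁.prod I₂) I ∞ ι) (hisom : IsWarpedIsometry I I₁ I₂ ι f)
    (hf : ContMDiff I₁ 𝓘(ℝ, ℝ) ∞ f) (hf_pos : ∀ b, 0 < f b)
    (hc : HasKenmotsuFactor A nabla c)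
    (hslant : IsPointwiseSemiSlant (I₁.prod I₂) A ι (tangentBase I₁ I₂) (tangentFibre I₁ I₂) θ)
    (hξ : ∀ p, A.xi (ι p) ∈ (tangentImage I (I₁.prod I₂) ι p)ᗮ)
    (hdim : Module.finrank ℝ E = Module.finrank ℝ E₁ + 2 * Module.finrank ℝ E₂ + 1)
    (hθ : θ p ∈ Set.Ioo 0 (Real.pi / 2)) {k : ℕ}
    (hk : k = Module.finrank ℝ E₁ + Module.finrank ℝ E₂)
    {e : Fin k → TangentSpace (I₁.prod I₂) p} (he : IsWarpedOrthonormal I₁ I₂ f p e) :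
    ∃ S : ℝ, 0 ≤ S ∧ (S = 0 ↔ ∀ Z ∈ tangentFibre I₁ I₂ p, ∀ W ∈ tangentFibre I₁ I₂ p,
        ∀ V ∈ (tangentImage I (I₁.prod I₂) ι p)ᗮ,
          (inner ℝ (secondFF (I₁.prod I₂) nabla ι p Z W) V : ℝ) = 0) ∧
      secondFFSqNorm (I₁.prod I₂) nabla ι p e = Module.finrank ℝ E₁ * c ^ 2 +
        2 * Module.finrank ℝ E₂ * ((1 / Real.sin (θ p)) ^ 2 + Real.cot (θ p) ^ 2) *
          ‖grad I₁ (fun b => Real.log (f b)) p.1‖ ^ 2 + S := by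
  obtain ⟨x, z, hx, hz, hxz⟩ := exists_adapted_frame I₁ I₂ hf_pos p
  have hs : 0 < Real.sin (θ p) :=
    Real.sin_pos_of_pos_of_lt_pi hθ.1 (by linarith [hθ.2, Real.pi_pos])
  set L : TangentSpace (I₁.prod I₂) p →ₗ[ℝ] TangentSpace I (ι p) :=
    (mfderiv (I₁.prod I₂) I ι p).toLinearMap with hL
  set K : Submodule ℝ (TangentSpace I (ι p)) := (tangentFibre I₁ I₂ p).map L with hK
  have hLinj : Function.Injective L := hisom.injective hf_pos p
  have hLL : ∀ u v, (inner ℝ (L u) (L v) : ℝ) = warpedMetric I₁ I₂ f p u v := hisom p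
  have hLξ : ∀ u, (inner ℝ (L u) (A.xi (ι p)) : ℝ) = 0 := fun u =>
    (Submodule.mem_orthogonal _ _).1 (hξ p) _ ⟨u, rfl⟩
  have hbf : ∀ {y v}, y ∈ tangentBase I₁ I₂ p → v ∈ tangentFibre I₁ I₂ p →
      (inner ℝ (L y) (L v) : ℝ) = 0 := fun hy hv => inner_base_fibre hisom hy hv
  have hφφ : ∀ u v, (inner ℝ (A.phi (ι p) (L u)) (A.phi (ι p) (L v)) : ℝ) =
      inner ℝ (L u) (L v) := fun u v => by
    rw [A.compatible, A.eta_eq_inner, hLξ, zero_mul, sub_zero]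
  have hons : Orthonormal ℝ (L ∘ Sum.elim x z) :=
    orthonormal_iff_ite.2 fun u v => by rw [Function.comp, Function.comp, hLL, hxz]
  have hone : Orthonormal ℝ (L ∘ e) :=
    orthonormal_iff_ite.2 fun u v => by rw [Function.comp, Function.comp, hLL, he]
  have honz : Orthonormal ℝ (fun a => L (z a)) := hons.comp Sum.inr Sum.inr_injective
  have hons' : Orthonormal ℝ (Sum.elim (fun i => L (x i)) fun a => L (z a)) := by
    rwa [Sum.comp_elim] at hons
  -- `x' i` represents `φ x_i` and `t a` represents `T z_a`.
  choose x' hx' hxx' using fun i => hslant.phi_invariant p _ (hx i)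
  choose t ht hts htn using fun a => exists_phi_fibre hisom hslant (hz a)
  have hzK : ∀ a, L (z a) ∈ K := fun a => Submodule.mem_map_of_mem (hz a)
  have hKL : ∀ v ∈ K, ∃ w ∈ tangentFibre I₁ I₂ p, L w = v := fun v hv => Submodule.mem_map.1 hv
  have hxK : ∀ i, ∀ v ∈ K, (inner ℝ (L (x i)) v : ℝ) = 0 := by
    intro i v hv
    obtain ⟨w, hw, rfl⟩ := hKL v hv
    exact hbf (hx i) hw
  have hKξ : ∀ v ∈ K, (inner ℝ v (A.xi (ι p)) : ℝ) = 0 := by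
    intro v hv
    obtain ⟨w, hw, rfl⟩ := hKL v hv
    exact hLξ w
  have hφK : ∀ v ∈ K, ∀ w ∈ K,
      (inner ℝ (A.phi (ι p) v) (A.phi (ι p) w) : ℝ) = inner ℝ v w := by
    intro v hv w hw
    obtain ⟨v, -, rfl⟩ := hKL v hv
    obtain ⟨w, -, rfl⟩ := hKL w hw
    exact hφφ v w
  have hθK : ∀ v ∈ K, v ≠ 0 → angleWithSubspace K (A.phi (ι p) v) = θ p := by
    intro v hv h0
    obtain ⟨w, hw, rfl⟩ := hKL v hv
    exact (hslant.slant p w hw fun h => h0 (by rw [h, map_zero])).2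
  have hframe := orthonormal_slant_frame (φ := (A.phi (ι p)).toLinearMap) (ξ := A.xi (ι p))
    hons' hxK hzK (by
      intro i v hv
      obtain ⟨w, hw, rfl⟩ := hKL v hv
      have h1 := A.inner_phi_left (ι p) (L (x i)) (L w)
      have h2 : A.phi (ι p) (L (x i)) = L (x' i) := hxx' i
      rw [h2, hbf (hx' i) hw] at h1
      change (inner ℝ (L (x i)) (A.phi (ι p) (L w)) : ℝ) = 0
      linarith) (fun i => hLξ _) hKξ (A.inner_xi_xi _)
    (fun v => by
      change (inner ℝ (A.phi (ι p) v) (A.xi (ι p)) : ℝ) = 0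
      rw [← A.eta_eq_inner, A.eta_phi]) hφK hθK hs
  have hdim' : Module.finrank ℝ (TangentSpace I (ι p)) =
      Fintype.card (Fin (Module.finrank ℝ E₁)) + 2 * Fintype.card (Fin (Module.finrank ℝ E₂)) + 1 := by
    rw [Fintype.card_fin, Fintype.card_fin]
    exact hdim
  have hnorm : ∀ v ∈ K, ‖v‖ ^ 2 = ∑ a, (inner ℝ v (L (z a)) : ℝ) ^ 2 := fun v hv =>
    norm_sq_of_mem_slant hframe hdim' hxK hKξ hv
  have htL : ∀ a, L (t a) = K.starProjection (A.phi (ι p) (L (z a))) := hts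
  -- `T` inherits skewness from `φ`.
  have hτ : ∀ a b, (inner ℝ (L (z a)) (L (t b)) : ℝ) = -inner ℝ (L (t a)) (L (z b)) := by
    intro a b
    have h1 : ∀ a b, (inner ℝ (L (z a)) (L (t b)) : ℝ) =
        inner ℝ (L (z a)) (A.phi (ι p) (L (z b))) := fun a b => by
      have h2 := (Submodule.mem_orthogonal _ _).1 (htn b) _ ⟨z a, rfl⟩
      rw [inner_sub_right] at h2
      change (inner ℝ (L (z a)) (A.phi (ι p) (L (z b))) - inner ℝ (L (z a)) (L (t b)) : ℝ) = 0
        at h2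
      linarith
    rw [h1, real_inner_comm (L (z b)), h1, real_inner_comm, A.inner_phi_left,
      real_inner_comm]
  -- By skewness and Parseval in `K` the sum is `|T z_a|²`, which is `cos² θ` by the slant
  -- condition.
  have hτk : ∀ a, ∑ b, (inner ℝ (L (z a)) (L (t b)) : ℝ) ^ 2 = Real.cos (θ p) ^ 2 := by
    intro a
    have h1 := inner_starProjection_of_slant (A.phi (ι p)).toLinearMap
      (fun v hv => by
        rw [norm_eq_sqrt_real_inner, norm_eq_sqrt_real_inner v]
        exact congrArg _ (hφK v hv v hv)) hθK (hzK a) (hzK a)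
    have h2 : (inner ℝ (L (t a)) (L (t a)) : ℝ) =
        Real.cos (θ p) ^ 2 * inner ℝ (L (z a)) (L (z a)) := by
      rw [htL]
      exact h1
    simp only [hτ, neg_sq]
    rw [← hnorm _ (Submodule.mem_map_of_mem (ht a)), ← real_inner_self_eq_norm_sq, h2,
      real_inner_self_eq_norm_sq, honz.1]
    ring
  have hxone : ∀ i j, (inner ℝ (L (x i)) (L (x j)) : ℝ) = if i = j then 1 else 0 := fun i j => by
    rw [hLL]
    simpa using hxz (Sum.inl i) (Sum.inl j)
  have hzone : ∀ i j, (inner ℝ (L (z i)) (L (z j)) : ℝ) = if i = j then 1 else 0 := fun i j => by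
    rw [hLL]
    simpa using hxz (Sum.inr i) (Sum.inr j)
  have hl : ∑ i, dLog I₁ I₂ f p (x i) ^ 2 = ‖grad I₁ (fun b => Real.log (f b)) p.1‖ ^ 2 :=
    sum_sq_dLog hisom (Fintype.card_fin _) hx hxone
  -- `φ` preserves inner products on the tangent space because `η` vanishes there, so the `x' i` are
  -- orthonormal and compute the same gradient norm.
  have hl' : ∑ i, dLog I₁ I₂ f p (x' i) ^ 2 = ‖grad I₁ (fun b => Real.log (f b)) p.1‖ ^ 2 :=
    sum_sq_dLog hisom (Fintype.card_fin _) hx' fun i j => by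
      rw [← hxx', ← hxx']
      exact (hφφ _ _).trans (hxone i j)
  have htan : ∀ u v w, (inner ℝ (secondFF (I₁.prod I₂) nabla ι p u v) (L w) : ℝ) = 0 :=
    fun u v w => by
      rw [real_inner_comm]
      exact (Submodule.mem_orthogonal _ _).1 (secondFF_mem u v) _ ⟨w, rfl⟩
  have hF : ∀ u i b, (inner ℝ (secondFF (I₁.prod I₂) nabla ι p u (x i))
      (A.phi (ι p) (L (z b)) - K.starProjection (A.phi (ι p) (L (z b)))) : ℝ) =
      -tangentialCov nabla ι u (x' i) (z b) - tangentialCov nabla ι u (x i) (t b) :=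
    fun u i b => by
      rw [← htL]
      exact inner_secondFF_base hnabla hι hisom hc hslant hξ (hx i) (hx' i) (hz b) (hxx' i) (htn b)
  have hsum := sum_sq_norm_frame hframe hdim'
    (fun u v => secondFF (I₁.prod I₂) nabla ι p (Sum.elim x z u) (Sum.elim x z v))
    (fun u v => secondFF_comm hnabla hι _ _) (fun u v i => htan _ _ _) (fun u v a => htan _ _ _)
    (c := c) (k := Real.cos (θ p) ^ 2) (l := fun i => dLog I₁ I₂ f p (x i))
    (l' := fun i => dLog I₁ I₂ f p (x' i)) (τ := fun a b => inner ℝ (L (z a)) (L (t b)))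
    (fun i j b => by
      refine (hF _ _ _).trans ?_
      rw [Sum.elim_inl, tangentialCov_base_base_fibre hnabla hι hisom (hx _) (hx' _) (hz _),
        tangentialCov_base_base_fibre hnabla hι hisom (hx _) (hx _) (ht _), neg_zero, sub_zero])
    (fun i j => by
      refine (inner_secondFF_xi hnabla hι hc hξ _ _).trans ?_
      have h := hxone i j
      rw [Sum.elim_inl, Sum.elim_inl]
      change -c * (inner ℝ (L (x i)) (L (x j)) : ℝ) = _
      rw [h, mul_ite, mul_one, mul_zero])
    (fun a i b => by
      refine (hF _ _ _).trans ?_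
      rw [Sum.elim_inr, tangentialCov_fibre_base_fibre hnabla hι hisom hf hf_pos (hx' _) (hz _) (hz _),
        tangentialCov_fibre_base_fibre hnabla hι hisom hf hf_pos (hx _) (hz _) (ht _)]
      change -(dLog I₁ I₂ f p (x' i) * (inner ℝ (L (z a)) (L (z b)) : ℝ)) -
        dLog I₁ I₂ f p (x i) * (inner ℝ (L (z a)) (L (t b)) : ℝ) = _
      rw [hzone, mul_ite, mul_one, mul_zero])
    (fun a i => by
      refine (inner_secondFF_xi hnabla hι hc hξ _ _).trans ?_
      rw [Sum.elim_inl, Sum.elim_inr, real_inner_comm]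
      change -c * (inner ℝ (L (x i)) (L (z a)) : ℝ) = _
      rw [hbf (hx i) (hz a), mul_zero])
    (fun a => by
      have h := hτ a a
      rw [real_inner_comm] at h
      change (inner ℝ (L (z a)) (L (t a)) : ℝ) = 0
      rw [real_inner_comm]
      linarith) hτk
  have hT : Module.finrank ℝ (TangentSpace (I₁.prod I₂) p) =
      Module.finrank ℝ E₁ + Module.finrank ℝ E₂ := Module.finrank_prod
  -- The given frame `e` is arbitrary; the sum is moved to the adapted frame.
  have hbasis := sum_sq_norm_bilin_eq hLinj hone hons
    ((Fintype.card_fin _).trans (hk.trans hT.symm)) (by simp [hT])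
    (secondFFBilin p hnabla hι)
  -- The excess `S` is the fibre-fibre block, the only part of `h` left undetermined.
  refine ⟨∑ a, ∑ b, ‖secondFF (I₁.prod I₂) nabla ι p (z a) (z b)‖ ^ 2, by positivity, ?_, ?_⟩
  · constructor
    · intro h Z hZ W hW V _
      have h1 : ∀ a b, secondFFBilin p hnabla hι (z a) (z b) = 0 := fun a b => by
        have h2 := (Finset.sum_eq_zero_iff_of_nonneg fun a _ => by positivity).1 h a
          (Finset.mem_univ _)
        have h3 := (Finset.sum_eq_zero_iff_of_nonneg fun a _ => by positivity).1 h2 b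
          (Finset.mem_univ _)
        exact norm_eq_zero.1 (sq_eq_zero_iff.1 h3)
      have hspan : ∀ w ∈ tangentFibre I₁ I₂ p, ∃ a : Fin (Module.finrank ℝ E₂) → ℝ,
          w = ∑ b, a b • z b := fun w hw => ⟨_, hLinj (by
        have h2 := eq_sum_of_norm_sq_eq honz hzK hnorm (Submodule.mem_map_of_mem hw)
        rw [map_sum]
        simp only [map_smul]
        exact h2)⟩
      obtain ⟨a, rfl⟩ := hspan Z hZ
      obtain ⟨b, rfl⟩ := hspan W hW
      have h4 : secondFFBilin p hnabla hι (∑ i, a i • z i) (∑ j, b j • z j) = 0 := by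
        simp only [map_sum, map_smul, LinearMap.sum_apply, LinearMap.smul_apply, h1, smul_zero,
          Finset.sum_const_zero]
      change (inner ℝ (secondFFBilin p hnabla hι (∑ i, a i • z i) (∑ j, b j • z j)) V : ℝ) = 0
      rw [h4, inner_zero_left]
    · intro h
      refine Finset.sum_eq_zero fun a _ => Finset.sum_eq_zero fun b _ => ?_
      rw [← real_inner_self_eq_norm_sq]
      exact h _ (hz a) _ (hz b) _ (secondFF_mem _ _)
  · have h1 : secondFFSqNorm (I₁.prod I₂) nabla ι p e =
        ∑ i, ∑ j, ‖secondFFBilin p hnabla hι (e i) (e j)‖ ^ 2 :=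
      Finset.sum_congr rfl fun i _ => Finset.sum_congr rfl fun j _ =>
        real_inner_self_eq_norm_sq _
    rw [h1, hbasis]
    refine hsum.trans ?_
    -- It remains that `csc² θ (1 + cos² θ) = csc² θ + cot² θ`.
    rw [hl, hl', Fintype.card_fin, Fintype.card_fin, Real.cot_eq_cos_div_sin]
    simp only [Sum.elim_inr]
    ring

end Identity

end

end SemiSlant

/-! ### The Kenmotsu and cosymplectic inequalities. -/

theorem theorem10p4 {m₁ m₂ n : ℕ} (hn : n = m₁ + 2 * m₂)
    -- the ambient Riemannian manifold, of dimension `2n + 1`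
    {N : Type*} [TopologicalSpace N] [ChartedSpace (EuclideanSpace ℝ (Fin (2 * n + 1))) N]
    [IsManifold (𝓡 (2 * n + 1)) ∞ N]
    [RiemannianBundle (fun x : N => TangentSpace (𝓡 (2 * n + 1)) x)]
    [IsContMDiffRiemannianBundle (𝓡 (2 * n + 1)) ∞ (EuclideanSpace ℝ (Fin (2 * n + 1)))
      (fun x : N => TangentSpace (𝓡 (2 * n + 1)) x)]
    -- its Levi-Civita connection
    (nabla : CovariantDerivative (𝓡 (2 * n + 1)) (EuclideanSpace ℝ (Fin (2 * n + 1)))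
      (fun x : N => TangentSpace (𝓡 (2 * n + 1)) x))
    (hnabla : SemiSlant.IsLeviCivita nabla)
    -- its almost contact metric structure
    (A : SemiSlant.AlmostContactMetric (𝓡 (2 * n + 1)) N)
    -- the base of the warped product, of dimension `2m₁`
    {B : Type*} [TopologicalSpace B] [ChartedSpace (EuclideanSpace ℝ (Fin (2 * m₁))) B]
    [IsManifold (𝓡 (2 * m₁)) ∞ B]
    [RiemannianBundle (fun x : B => TangentSpace (𝓡 (2 * m₁)) x)]
    [IsContMDiffRiemannianBundle (𝓡 (2 * m₁)) ∞ (EuclideanSpace ℝ (Fin (2 * m₁)))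
      (fun x : B => TangentSpace (𝓡 (2 * m₁)) x)]
    -- the fibre of the warped product, of dimension `2m₂`
    {F : Type*} [TopologicalSpace F] [ChartedSpace (EuclideanSpace ℝ (Fin (2 * m₂))) F]
    [IsManifold (𝓡 (2 * m₂)) ∞ F]
    [RiemannianBundle (fun x : F => TangentSpace (𝓡 (2 * m₂)) x)]
    [IsContMDiffRiemannianBundle (𝓡 (2 * m₂)) ∞ (EuclideanSpace ℝ (Fin (2 * m₂)))
      (fun x : F => TangentSpace (𝓡 (2 * m₂)) x)]
    -- the warping function
    (f : B → ℝ) (hf : ContMDiff (𝓡 (2 * m₁)) 𝓘(ℝ, ℝ) ∞ f) (hf_pos : ∀ b, 0 < f b)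
    -- `M = B ×_f F` is an isometrically immersed submanifold of `N`
    (ι : B × F → N)
    (hι : ContMDiff ((𝓡 (2 * m₁)).prod (𝓡 (2 * m₂))) (𝓡 (2 * n + 1)) ∞ ι)
    (hι_isom : ∀ (p : B × F) (u v : TangentSpace ((𝓡 (2 * m₁)).prod (𝓡 (2 * m₂))) p),
      (inner ℝ (mfderiv ((𝓡 (2 * m₁)).prod (𝓡 (2 * m₂))) (𝓡 (2 * n + 1)) ι p u)
        (mfderiv ((𝓡 (2 * m₁)).prod (𝓡 (2 * m₂))) (𝓡 (2 * n + 1)) ι p v) : ℝ)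
        = SemiSlant.warpedMetric (𝓡 (2 * m₁)) (𝓡 (2 * m₂)) f p u v)
    -- it is proper pointwise semi-slant, with `D₁ = TB` and `D₂ = TF`
    (θ : B × F → ℝ)
    (hslant : SemiSlant.IsPointwiseSemiSlant ((𝓡 (2 * m₁)).prod (𝓡 (2 * m₂))) A ι
      (SemiSlant.tangentBase (𝓡 (2 * m₁)) (𝓡 (2 * m₂)))
      (SemiSlant.tangentFibre (𝓡 (2 * m₁)) (𝓡 (2 * m₂))) θ)
    (hproper : ∀ p, θ p ∈ Set.Ioo 0 (Real.pi / 2))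
    -- `ξ` is normal to `M` and lies in `μ`
    (hξ_normal : ∀ p, A.xi (ι p) ∈
      (SemiSlant.tangentImage (𝓡 (2 * n + 1)) ((𝓡 (2 * m₁)).prod (𝓡 (2 * m₂))) ι p)ᗮ)
    (hξ_mu : ∀ p, SemiSlant.MemMu ((𝓡 (2 * m₁)).prod (𝓡 (2 * m₂))) A ι
      (SemiSlant.tangentFibre (𝓡 (2 * m₁)) (𝓡 (2 * m₂))) p (A.xi (ι p))) :
    (A.IsKenmotsu nabla →
      ∀ (p : B × F) (e : Fin (2 * m₁ + 2 * m₂) →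
          TangentSpace ((𝓡 (2 * m₁)).prod (𝓡 (2 * m₂))) p),
        SemiSlant.IsWarpedOrthonormal (𝓡 (2 * m₁)) (𝓡 (2 * m₂)) f p e →
        4 * m₂ * ((1 / Real.sin (θ p)) ^ 2 + Real.cot (θ p) ^ 2)
            * ‖SemiSlant.grad (𝓡 (2 * m₁)) (fun b => Real.log (f b)) p.1‖ ^ 2 + 2 * m₁
          ≤ SemiSlant.secondFFSqNorm ((𝓡 (2 * m₁)).prod (𝓡 (2 * m₂))) nabla ι p e ∧
        (SemiSlant.secondFFSqNorm ((𝓡 (2 * m₁)).prod (𝓡 (2 * m₂))) nabla ι p e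
          = 4 * m₂ * ((1 / Real.sin (θ p)) ^ 2 + Real.cot (θ p) ^ 2)
            * ‖SemiSlant.grad (𝓡 (2 * m₁)) (fun b => Real.log (f b)) p.1‖ ^ 2 + 2 * m₁ ↔
          ∀ Z ∈ SemiSlant.tangentFibre (𝓡 (2 * m₁)) (𝓡 (2 * m₂)) p,
          ∀ W ∈ SemiSlant.tangentFibre (𝓡 (2 * m₁)) (𝓡 (2 * m₂)) p,
          ∀ V ∈ (SemiSlant.tangentImage (𝓡 (2 * n + 1))
              ((𝓡 (2 * m₁)).prod (𝓡 (2 * m₂))) ι p)ᗮ,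
            (inner ℝ (SemiSlant.secondFF ((𝓡 (2 * m₁)).prod (𝓡 (2 * m₂))) nabla ι p Z W)
              V : ℝ) = 0)) ∧
    (A.IsCosymplectic →
      ∀ (p : B × F) (e : Fin (2 * m₁ + 2 * m₂) →
          TangentSpace ((𝓡 (2 * m₁)).prod (𝓡 (2 * m₂))) p),
        SemiSlant.IsWarpedOrthonormal (𝓡 (2 * m₁)) (𝓡 (2 * m₂)) f p e →
        4 * m₂ * ((1 / Real.sin (θ p)) ^ 2 + Real.cot (θ p) ^ 2)
            * ‖SemiSlant.grad (𝓡 (2 * m₁)) (fun b => Real.log (f b)) p.1‖ ^ 2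
          ≤ SemiSlant.secondFFSqNorm ((𝓡 (2 * m₁)).prod (𝓡 (2 * m₂))) nabla ι p e ∧
        (SemiSlant.secondFFSqNorm ((𝓡 (2 * m₁)).prod (𝓡 (2 * m₂))) nabla ι p e
          = 4 * m₂ * ((1 / Real.sin (θ p)) ^ 2 + Real.cot (θ p) ^ 2)
            * ‖SemiSlant.grad (𝓡 (2 * m₁)) (fun b => Real.log (f b)) p.1‖ ^ 2 ↔
          ∀ Z ∈ SemiSlant.tangentFibre (𝓡 (2 * m₁)) (𝓡 (2 * m₂)) p,
          ∀ W ∈ SemiSlant.tangentFibre (𝓡 (2 * m₁)) (𝓡 (2 * m₂)) p,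
          ∀ V ∈ (SemiSlant.tangentImage (𝓡 (2 * n + 1))
              ((𝓡 (2 * m₁)).prod (𝓡 (2 * m₂))) ι p)ᗮ,
            (inner ℝ (SemiSlant.secondFF ((𝓡 (2 * m₁)).prod (𝓡 (2 * m₂))) nabla ι p Z W)
              V : ℝ) = 0)) := by
  -- `n = m₁ + 2 m₂` is exactly `2n + 1 = 2m₁ + 2 (2m₂) + 1`, the size of the adapted frame.
  have hfin : Module.finrank ℝ (EuclideanSpace ℝ (Fin (2 * n + 1))) =
      Module.finrank ℝ (EuclideanSpace ℝ (Fin (2 * m₁))) +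
        2 * Module.finrank ℝ (EuclideanSpace ℝ (Fin (2 * m₂))) + 1 := by
    simp only [finrank_euclideanSpace_fin]
    omega
  refine ⟨fun hK p e he => ?_, fun hC p e he => ?_⟩
  -- Here `c = 1`, so the base block contributes `2 m₁`; the coefficient `4 m₂` is `2 dim F`.
  · obtain ⟨S, hS, hS0, h⟩ := SemiSlant.exists_secondFFSqNorm_eq hnabla hι hι_isom hf hf_pos
      hK.hasKenmotsuFactor hslant hξ_normal hfin (hproper p) (by simp) he
    simp only [finrank_euclideanSpace_fin] at h
    push_cast at h
    rw [← hS0, h]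
    constructor
    · linarith
    · constructor <;> intro h' <;> linarith
  -- Here `c = 0`, and the base block disappears.
  · obtain ⟨S, hS, hS0, h⟩ := SemiSlant.exists_secondFFSqNorm_eq hnabla hι hι_isom hf hf_pos
      (SemiSlant.AlmostContactMetric.IsCosymplectic.hasKenmotsuFactor hnabla hC) hslant hξ_normal
      hfin (hproper p) (by simp) he
    simp only [finrank_euclideanSpace_fin] at h
    push_cast at h
    rw [← hS0, h]
    constructor
    · linarith
    · constructor <;> intro h' <;> linarith
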